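/- \textbf{Conventions.} A symbolic system over a finite alphabet $\Sigma$ is a closed shift-invariant subset of $\Sigma^{\mathbb Z}$; it is minimal if it is non-empty and has no proper non-empty subsystem. Invariant measures are shift-invariant Borel probability measures. A sequence $x\in\Sigma^{\mathbb Z}$ is Toeplitz if for every $i\in\mathbb Z$ there is $p\ge 1$ with $x(i+pj)=x(i)$ for all $j\in\mathbb Z$. For integers $k_n\ge 2$ the odometer based on $\langle k_n\rangle$ is $\prod_n \mathbb Z/k_n\mathbb Z$ with the map "add $1$ to the $0$-th digit and carry to the right". It is the maximal odometer factor of a system $\mathbb L$, via a continuous equivariant surjection $\pi$ from $\mathbb L$ onto it, if every continuous equivariant surjection from $\mathbb L$ onto an odometer factors continuously through $\pi$. A set of words $\mathcal W$ is uniquely readable if $uv=pws$ with $u,v,w\in\mathcal W$ implies that $p$ or $s$ is empty. A construction sequence in a finite alphabet $S$ is a sequence $\langle\mathcal W_n\rangle_{n\in\mathbb N}$ of non-empty sets of words such that $\mathcal W_0=S$; all words of $\mathcal W_n$ have the same length $q_n$; each $\mathcal W_n$ is uniquely readable; every $w\in\mathcal W_n$ is a subword of every $w'\in\mathcal W_{n+1}$;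 and for some summable sequence of $\epsilon_n>0$, every $w\in\mathcal W_{n+1}$ has exactly one parsing $w=u_0w_0u_1w_1\cdots u_lw_lu_{l+1}$ with $w_i\in\mathcal W_n$ and arbitrary words $u_i$ for which $\sum_i|u_i|/q_{n+1}<\epsilon_{n+1}$. Its limit is the set of bi-infinite sequences all of whose finite subwords occur in some word of some $\mathcal W_n$. A symbolic system is odometer based if it is the limit of a construction sequence with $\mathcal W_{n+1}\subseteq\mathcal W_n^{l_n}$ for some integers $l_n\ge 2$. (The alphabet $S$ consists of the symbols that are used; for a system contained in $(\Sigma\times\Gamma)^{\mathbb Z}$ it is a subset of $\Sigma\times\Gamma$.) For minimal symbolic systems $X,Y$, an augmentation of $X$ by $Y$ is a shift-invariant Borel set $A\subseteq X\times Y$ such that for every invariant measure $\mu$ on $X$, for $\mu$-almost every $x\in X$ there is exactly one $y$ with $(x,y)\in A$. \textbf{Proposition.} Let $\mathbb L$ be the orbit closure (under the shift) of a Toeplitz sequence over a finite alphabet $\Sigma$. Suppose that the odometer $\mathfrak O$ based on $\langle k_n:n\in\mathbb N\rangle$ is the maximal odometer factor of $\mathbb L$, where $\langle k_n\rangle$ is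 fast growing in the sense that $k_n\ge 10$ for all $n$ and $\sum_n 1/k_n<\infty$. Let $\mathbb K\subseteq\{a,b\}^{\mathbb Z}$ be the odometer based presentation of $\mathfrak O$: the limit of $\mathcal W_n=\{a_n,b_n\}$, where $a_0=a$, $b_0=b$ and $a_{n+1}$, $b_{n+1}$ are the concatenations of $k_n$ words \[a_{n+1}=a_na_na_nb_nb_nb_n\,a_nb_na_nb_n\cdots,\qquad b_{n+1}=b_nb_nb_na_na_na_n\,a_nb_na_nb_n\cdots\] (after the first six words, $a_n$ and $b_n$ alternate, starting with $a_n$). Then there are an odometer based system $\mathbb L^*\subseteq\mathbb L\times\mathbb K\subseteq(\Sigma\times\{a,b\})^{\mathbb Z}$ and a set $A\subseteq\mathbb L^*$ such that $\mathbb L$ and $\mathbb K$ are minimal, $A$ is an augmentation of $\mathbb L$ by $\mathbb K$, and $\nu(A)=1$ for every invariant measure $\nu$ on $\mathbb L^*$. -/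

import Mathlib

open MeasureTheory Topology

/-! ### Shift spaces -/

/-- The shift map on bi-infinite sequences. -/
def shift {α : Type*} (z : ℤ → α) : ℤ → α := fun i => z (i + 1)

/-- A symbolic system: a closed, shift-invariant set of bi-infinite sequences. -/
structure IsSymbolicSystem {α : Type*} [TopologicalSpace α] (X : Set (ℤ → α)) : Prop where
  isClosed : IsClosed X
  invariant : shift ⁻¹' X = X

/-- A minimal symbolic system: nonempty, and without proper nonempty subsystems. -/
structure IsMinimalSystem {α : Type*} [TopologicalSpace α] (X : Set (ℤ → α)) : Prop where
  isSymbolicSystem : IsSymbolicSystem X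
  nonempty : X.Nonempty
  eq_of_subset : ∀ Y : Set (ℤ → α), IsSymbolicSystem Y → Y.Nonempty → Y ⊆ X → Y = X

/-- `μ` is a shift-invariant (Borel) probability measure on the system `X`, viewed as a measure on
the full shift that is carried by `X`. -/
structure IsInvariantMeasureOn {α : Type*} [MeasurableSpace α] (X : Set (ℤ → α))
    (μ : Measure (ℤ → α)) : Prop where
  isProbabilityMeasure : IsProbabilityMeasure μ
  compl_eq_zero : μ Xᶜ = 0
  measurePreserving : MeasurePreserving shift μ μ

/-- The orbit closure of a bi-infinite sequence under the shift. -/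
def orbitClosure {α : Type*} [TopologicalSpace α] (x : ℤ → α) : Set (ℤ → α) :=
  closure (Set.range fun n : ℤ => fun i : ℤ => x (i + n))

/-- A Toeplitz sequence: every position lies in an arithmetic progression along which
the sequence is constant. -/
def IsToeplitz {α : Type*} (x : ℤ → α) : Prop :=
  ∀ i : ℤ, ∃ p : ℕ, 1 ≤ p ∧ ∀ j : ℤ, x (i + p * j) = x i

/-! ### Odometers -/

/-- The underlying space of the odometer with coefficient sequence `k`, a product of the discrete
spaces `ℤ / k i ℤ` with the product topology. -/
abbrev OdometerSpace (k : ℕ → ℕ) : Type := ∀ i : ℕ, ZMod (k i)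

/-- The odometer transformation: add one to the digit with index `0` and carry to the right.
The `n`-th digit changes exactly if all earlier digits are equal to `k i - 1 = -1`. -/
noncomputable def odometer (k : ℕ → ℕ) (o : OdometerSpace k) : OdometerSpace k :=
  open Classical in fun n => if ∀ i < n, o i = -1 then o n + 1 else o n

/-- `π` (only its values on `X` matter) is a topological factor map from the system `X` onto
the odometer with coefficient sequence `k`. -/
structure IsOdometerFactor {α : Type*} [TopologicalSpace α] (X : Set (ℤ → α)) (k : ℕ → ℕ)
    (π : (ℤ → α) → OdometerSpace k) : Prop where
  two_le : ∀ n, 2 ≤ k n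
  continuousOn : ContinuousOn π X
  surjOn : Set.SurjOn π X Set.univ
  map_shift : ∀ z ∈ X, π (shift z) = odometer k (π z)

/-- `π` is the maximal odometer factor of `X`: every factor map from `X` onto an odometer
factors continuously through `π`. -/
structure IsMaximalOdometerFactor {α : Type*} [TopologicalSpace α] (X : Set (ℤ → α)) (k : ℕ → ℕ)
    (π : (ℤ → α) → OdometerSpace k) : Prop extends IsOdometerFactor X k π where
  maximal : ∀ (k' : ℕ → ℕ) (π' : (ℤ → α) → OdometerSpace k'), IsOdometerFactor X k' π' →
    ∃ θ : OdometerSpace k → OdometerSpace k', Continuous θ ∧ ∀ z ∈ X, π' z = θ (π z)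

/-! ### Construction sequences -/

/-- Unique readability of a collection of words. -/
def UniquelyReadable {α : Type*} (W : Set (List α)) : Prop :=
  ∀ u ∈ W, ∀ v ∈ W, ∀ w ∈ W, ∀ p s : List α, u ++ v = p ++ w ++ s → p = [] ∨ s = []

/-- The pair `([(u₀, w₀), …, (uₗ, wₗ)], uₗ₊₁)` is a parsing `w = u₀ w₀ u₁ w₁ … uₗ wₗ uₗ₊₁` of `w`
into words `wᵢ ∈ W` and spacers `uᵢ`. -/
def IsParsing {α : Type*} (W : Set (List α)) (w : List α)
    (P : List (List α × List α) × List α) : Prop :=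
  P.1 ≠ [] ∧ (∀ b ∈ P.1, b.2 ∈ W) ∧ P.1.flatMap (fun b => b.1 ++ b.2) ++ P.2 = w

/-- The total length of the spacers of a parsing. -/
def spacerLength {α : Type*} (P : List (List α × List α) × List α) : ℕ :=
  (P.1.map fun b => b.1.length).sum + P.2.length

/-- A construction sequence in the finite alphabet `S` (a set of symbols from `α`), with words of
length `q n` at stage `n`. -/
structure IsConstructionSequence {α : Type*} (S : Set α) (q : ℕ → ℕ)
    (W : ℕ → Set (List α)) : Prop where
  finite_alphabet : S.Finite
  nonempty : ∀ n, (W n).Nonempty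
  zero : W 0 = {w | ∃ s ∈ S, w = [s]}
  length_eq : ∀ n, ∀ w ∈ W n, w.length = q n
  uniquelyReadable : ∀ n, UniquelyReadable (W n)
  occurs : ∀ n, ∀ w ∈ W n, ∀ w' ∈ W (n + 1), w <:+: w'
  parsing : ∃ ε : ℕ → ℝ, Summable ε ∧ (∀ n, 0 < ε n) ∧ ∀ n, ∀ w ∈ W (n + 1),
    ∃! P : List (List α × List α) × List α,
      IsParsing (W n) w P ∧ (spacerLength P : ℝ) / q (n + 1) < ε (n + 1)

/-- The finite subword of `z` of length `l` that starts at position `m`. -/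
def subword {α : Type*} (z : ℤ → α) (m : ℤ) (l : ℕ) : List α :=
  List.ofFn fun i : Fin l => z (m + (i : ℕ))

/-- The limit of a sequence of collections of words: all bi-infinite sequences each of whose finite
subwords occurs inside some word of some `W n`. -/
def limitSystem {α : Type*} (W : ℕ → Set (List α)) : Set (ℤ → α) :=
  {z | ∀ (m : ℤ) (l : ℕ), ∃ n, ∃ w ∈ W n, subword z m l <:+: w}

/-- A symbolic system is odometer based if it is the limit of a construction sequence without
spacers: `W (n + 1) ⊆ (W n) ^ (k n)` for a coefficient sequence `k`. -/
def IsOdometerBased {α : Type*} (X : Set (ℤ → α)) : Prop :=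
  ∃ (S : Set α) (q k : ℕ → ℕ) (W : ℕ → Set (List α)),
    IsConstructionSequence S q W ∧ (∀ n, 2 ≤ k n) ∧
    (∀ n, ∀ w ∈ W (n + 1), ∃ ws : List (List α),
      ws.length = k n ∧ (∀ v ∈ ws, v ∈ W n) ∧ ws.flatten = w) ∧
    X = limitSystem W

/-! ### The odometer based presentation of an odometer

The letters `a`, `b` are `false`, `true : Bool`. -/

/-- The letter at position `j` of the pattern `aaabbbababab…` (for `c = a`), respectively
`bbbaaaababab…` (for `c = b`). -/
def presentationPattern (c : Bool) (j : ℕ) : Bool :=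
  if j < 3 then c else if j < 6 then !c else decide (j % 2 = 1)

/-- The words `aₙ` (for `c = a`) and `bₙ` (for `c = b`): `a₀ = a`, `b₀ = b`, and `aₙ₊₁`, `bₙ₊₁` are
the concatenations of `k n` words `aₙ`, `bₙ` in the order given by the two patterns. -/
def presentationWord (k : ℕ → ℕ) : ℕ → Bool → List Bool
  | 0, c => [c]
  | n + 1, c => (List.range (k n)).flatMap fun j => presentationWord k n (presentationPattern c j)

/-- The odometer based presentation of the odometer with coefficient sequence `k`: the limit of
the collections `{aₙ, bₙ}`. -/
def odometerPresentation (k : ℕ → ℕ) : Set (ℤ → Bool) :=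
  limitSystem fun n => Set.range (presentationWord k n)

/-! ### Augmentations -/

/-- The product of two systems, as a set of sequences in the product alphabet. -/
def prodSystem {α β : Type*} (X : Set (ℤ → α)) (Y : Set (ℤ → β)) : Set (ℤ → α × β) :=
  {z | (fun i => (z i).1) ∈ X ∧ (fun i => (z i).2) ∈ Y}

/-- `A` is an augmentation of the minimal symbolic system `X` by the minimal symbolic system `Y`. -/
structure IsAugmentation {α β : Type*} [TopologicalSpace α] [MeasurableSpace α]
    [TopologicalSpace β] [MeasurableSpace β] (X : Set (ℤ → α)) (Y : Set (ℤ → β))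
    (A : Set (ℤ → α × β)) : Prop where
  minimal_left : IsMinimalSystem X
  minimal_right : IsMinimalSystem Y
  subset_prod : A ⊆ prodSystem X Y
  measurableSet : MeasurableSet A
  invariant : shift ⁻¹' A = A
  ae_existsUnique : ∀ μ : Measure (ℤ → α), IsInvariantMeasureOn X μ →
    ∀ᵐ x ∂μ, ∃! y : ℤ → β, (fun i => (x i, y i)) ∈ A

/-! ### Subwords -/

section Subword

variable {α β : Type*}

/-! Write `q n` for the common length of `aₙ`, `bₙ`. The first `n` digits of the odometer factor
tell, for each point of the Toeplitz system `X`, where `0` lies in its block of length `q n`. The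
fibre product consists of the pairs `(x, y)` in which `y` is cut into words `aₙ`, `bₙ` exactly at
the block boundaries of `x`, for every `n`. It is a non-empty subsystem of the product, and `L` is a
minimal subsystem of it.

`L` is odometer based (`IsMinimalSystem.isOdometerBased`): its words are the blocks along a sparse
sequence of stages. They are uniquely readable because their second coordinates are `aₙ` or `bₙ`,
where the prefix `aaabbb` or `bbbaaa` marks the beginning of a word (`presentationLetter_readable`).
Minimality makes every block occur in every block of the next chosen stage.

`aₙ₊₁` and `bₙ₊₁` agree after their first six subblocks. So `x` determines the letter of `y` at
every position that escapes the first six subblocks at some stage (`eq_of_mem_fiberProduct`).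
Positions in the blocks are equidistributed, so a given position fails to escape with probability at
most `6 / k n` for every `n`, hence with probability `0`
(`IsInvariantMeasureOn.measure_undetermined`). Removing the points of `L` with such a position
leaves `A`. Uniqueness of `y` then holds on `A`, and existence holds almost everywhere because `L`
projects onto the minimal system `X`. -/

theorem length_subword (z : ℤ → α) (m : ℤ) (l : ℕ) : (subword z m l).length = l := by
  simp [subword]

theorem getElem_subword (z : ℤ → α) (m : ℤ) (l i : ℕ) (h : i < (subword z m l).length) :
    (subword z m l)[i] = z (m + i) := by
  simp [subword]

theorem subword_eq_iff {z z' : ℤ → α} {m m' : ℤ} {l : ℕ} :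
    subword z m l = subword z' m' l ↔ ∀ i : ℕ, i < l → z (m + i) = z' (m' + i) := by
  unfold subword
  rw [List.ofFn_inj, funext_iff]
  exact ⟨fun h i hi => h ⟨i, hi⟩, fun h i => h i i.2⟩

theorem map_subword (f : α → β) (z : ℤ → α) (m : ℤ) (l : ℕ) :
    (subword z m l).map f = subword (fun i => f (z i)) m l := by
  simp [subword, List.map_ofFn, Function.comp_def]

theorem subword_add (z : ℤ → α) (m : ℤ) (l l' : ℕ) :
    subword z m (l + l') = subword z m l ++ subword z (m + l) l' := by
  unfold subword
  rw [List.ofFn_add]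
  congr 2
  funext i
  simp [add_assoc]

theorem subword_isInfix_iff {z z' : ℤ → α} {m m' : ℤ} {l l' : ℕ} :
    subword z m l <:+: subword z' m' l' ↔
      ∃ d : ℕ, d + l ≤ l' ∧ ∀ i : ℕ, i < l → z (m + i) = z' (m' + d + i) := by
  constructor
  · rintro ⟨p, s, h⟩
    have hl := congrArg List.length h
    simp only [List.length_append, length_subword] at hl
    refine ⟨p.length, by omega, fun i hi => ?_⟩
    have h1 := congrArg (fun w => w[p.length + i]?) h
    simp only [List.append_assoc] at h1
    rw [List.getElem?_append_right (by omega), List.getElem?_append_left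
      (by rw [length_subword]; omega), List.getElem?_eq_getElem (by rw [length_subword]; omega),
      List.getElem?_eq_getElem (by rw [length_subword]; omega), getElem_subword,
      getElem_subword] at h1
    simpa [add_assoc] using h1
  · rintro ⟨d, hd, h⟩
    obtain ⟨e, rfl⟩ := Nat.exists_eq_add_of_le hd
    refine ⟨subword z' m' d, subword z' (m' + (d + l : ℕ)) e, ?_⟩
    rw [subword_add, subword_add, subword_eq_iff.2 h]

/-- A word of length `t * l` is the concatenation of its `t` consecutive subwords of length `l`. -/
theorem flatten_subwords (z : ℤ → α) (m : ℤ) (t l : ℕ) :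
    ((List.range t).map fun j => subword z (m + (j * l : ℕ)) l).flatten = subword z m (t * l) := by
  induction t with
  | zero => simp [subword]
  | succ t ih => rw [List.range_succ, List.map_append, List.flatten_append, ih, add_mul,
      subword_add]; simp

end Subword

/-- A letterwise map preserves lengths, so emptiness of `p` or `s` may be tested on images. This
transfers readability from the second coordinates to words over the product alphabet. -/
theorem UniquelyReadable.of_map {α β : Type*} (f : α → β) {V : Set (List β)} {W : Set (List α)}
    (hV : UniquelyReadable V) (h : ∀ w ∈ W, w.map f ∈ V) : UniquelyReadable W := by
  intro u hu v hv w hw p s e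
  have := hV _ (h u hu) _ (h v hv) _ (h w hw) (p.map f) (s.map f)
    (by simpa using congrArg (List.map f) e)
  simpa using this

/-! ### The words of the odometer based presentation -/

/-- The length of the words `aₙ`, `bₙ`. -/
def presentationLength (k : ℕ → ℕ) (n : ℕ) : ℕ := ∏ i ∈ Finset.range n, k i

/-- The letter at position `i` of the word `aₙ`, respectively `bₙ`. -/
def presentationLetter (k : ℕ → ℕ) : ℕ → Bool → ℕ → Bool
  | 0, c, _ => c
  | n + 1, c, i => presentationLetter k n
      (presentationPattern c (i / presentationLength k n)) (i % presentationLength k n)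

section Presentation

variable {k : ℕ → ℕ}

@[simp] theorem presentationLength_zero : presentationLength k 0 = 1 := by
  simp [presentationLength]

theorem presentationLength_succ (n : ℕ) :
    presentationLength k (n + 1) = k n * presentationLength k n := by
  simp [presentationLength, Finset.prod_range_succ, mul_comm]

theorem presentationLength_dvd {m n : ℕ} (h : m ≤ n) :
    presentationLength k m ∣ presentationLength k n :=
  Finset.prod_dvd_prod_of_subset _ _ _ (Finset.range_mono h)

theorem presentationLength_pos (hk : ∀ n, 0 < k n) (n : ℕ) : 0 < presentationLength k n :=
  Finset.prod_pos fun i _ => hk i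

theorem two_mul_presentationLength_le (hk : ∀ n, 2 ≤ k n) {m n : ℕ} (h : m < n) :
    2 * presentationLength k m ≤ presentationLength k n := by
  have hp := fun n => presentationLength_pos (k := k) (fun n => by have := hk n; omega) n
  calc 2 * presentationLength k m ≤ k m * presentationLength k m := Nat.mul_le_mul_right _ (hk m)
    _ = presentationLength k (m + 1) := (presentationLength_succ m).symm
    _ ≤ _ := Nat.le_of_dvd (hp n) (presentationLength_dvd h)

theorem two_pow_le_presentationLength (hk : ∀ n, 2 ≤ k n) (n : ℕ) :
    2 ^ n ≤ presentationLength k n := by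
  simpa [presentationLength] using
    Finset.prod_le_prod' (s := Finset.range n) (f := fun _ => 2) (g := k) fun i _ => hk i

theorem presentationLetter_zero_right (n : ℕ) (c : Bool) : presentationLetter k n c 0 = c := by
  induction n generalizing c with
  | zero => rfl
  | succ n ih => simp [presentationLetter, ih, presentationPattern]

theorem presentationLetter_succ (n : ℕ) (c : Bool) {j i : ℕ} (hi : i < presentationLength k n) :
    presentationLetter k (n + 1) c (j * presentationLength k n + i) =
      presentationLetter k n (presentationPattern c j) i := by
  have h0 : 0 < presentationLength k n := by omega
  rw [presentationLetter, mul_comm j, Nat.mul_add_div h0, Nat.mul_add_mod, Nat.mod_eq_of_lt hi,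
    Nat.div_eq_of_lt hi, add_zero]

/-- From the seventh block on, the two words of a stage agree. -/
theorem presentationLetter_succ_eq (hk : ∀ n, 0 < k n) (n : ℕ) (c c' : Bool) {i : ℕ}
    (hi : 6 * presentationLength k n ≤ i) :
    presentationLetter k (n + 1) c i = presentationLetter k (n + 1) c' i := by
  have h6 : 6 ≤ i / presentationLength k n :=
    (Nat.le_div_iff_mul_le (presentationLength_pos hk n)).2 hi
  have h (c : Bool) : presentationPattern c (i / presentationLength k n) =
      decide (i / presentationLength k n % 2 = 1) := by
    rw [presentationPattern, if_neg (by omega), if_neg (by omega)]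
  rw [presentationLetter, presentationLetter, h c, h c']

/-- Each word is a concatenation of words of any earlier stage. -/
theorem exists_presentationLetter_eq (hk : ∀ n, 0 < k n) {m n : ℕ} (h : m ≤ n) (c : Bool) (j : ℕ)
    (hj : j * presentationLength k m < presentationLength k n) :
    ∃ c', ∀ i < presentationLength k m,
      presentationLetter k n c (j * presentationLength k m + i) = presentationLetter k m c' i := by
  induction n, h using Nat.le_induction generalizing c j with
  | base =>
    have : j = 0 := by
      by_contra h0
      have := Nat.mul_le_mul_right (presentationLength k m) (Nat.one_le_iff_ne_zero.2 h0)
      omega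
    subst this
    exact ⟨c, fun i _ => by simp⟩
  | succ n h ih =>
    obtain ⟨t, ht⟩ := presentationLength_dvd (k := k) h
    have hm := presentationLength_pos hk m
    have ht0 : 0 < t := by
      rcases Nat.eq_zero_or_pos t with rfl | h0
      · have := presentationLength_pos hk n
        omega
      · exact h0
    -- With `t` blocks of stage `m` in a block of stage `n`, the block number `j` is number `j % t`
    -- inside subblock `j / t`.
    obtain ⟨c', hc'⟩ := ih (presentationPattern c (j / t)) (j % t) (by
      rw [ht, mul_comm]; exact Nat.mul_lt_mul_of_pos_left (Nat.mod_lt _ ht0) hm)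
    refine ⟨c', fun i hi => ?_⟩
    rw [← hc' i hi]
    have e : j * presentationLength k m + i =
        j / t * presentationLength k n + (j % t * presentationLength k m + i) := by
      conv_lhs => rw [← Nat.div_add_mod j t]
      rw [ht]; ring
    rw [e, presentationLetter_succ]
    have : (j % t + 1) * presentationLength k m ≤ t * presentationLength k m :=
      Nat.mul_le_mul_right _ (Nat.mod_lt _ ht0)
    rw [ht, mul_comm _ t]
    linarith

/-- The word of `K` consecutive blocks of length `q`. -/
theorem flatMap_range_map {β : Type*} {q : ℕ} (hq : 0 < q) (K : ℕ) (g : ℕ → ℕ → β) :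
    ((List.range K).flatMap fun j => (List.range q).map (g j)) =
      (List.range (K * q)).map fun i => g (i / q) (i % q) := by
  induction K with
  | zero => simp
  | succ K ih =>
    rw [List.range_succ, List.flatMap_append, ih, add_mul, one_mul, List.range_add,
      List.map_append]
    congr 1
    simp only [List.flatMap_cons, List.flatMap_nil, List.append_nil, List.map_map]
    refine List.map_congr_left fun i hi => ?_
    have hi := List.mem_range.1 hi
    simp [mul_comm K, Nat.mul_add_div hq, Nat.mod_eq_of_lt hi, Nat.div_eq_of_lt hi]

theorem presentationWord_eq_map (hk : ∀ n, 0 < k n) (n : ℕ) (c : Bool) :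
    presentationWord k n c =
      (List.range (presentationLength k n)).map (presentationLetter k n c) := by
  induction n generalizing c with
  | zero => simp [presentationWord, presentationLetter]
  | succ n ih =>
    rw [presentationWord, presentationLength_succ]
    simp only [ih]
    rw [flatMap_range_map (presentationLength_pos hk n)]
    rfl

theorem presentationWord_eq_subword (hk : ∀ n, 0 < k n) (n : ℕ) (c : Bool) :
    presentationWord k n c =
      subword (fun i : ℤ => presentationLetter k n c i.toNat) 0 (presentationLength k n) := by
  rw [presentationWord_eq_map hk]
  refine List.ext_getElem (by simp [length_subword]) fun i h1 h2 => ?_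
  simp [getElem_subword]

/-- `ccc` followed by three times the other letter appears in two consecutive patterns only at
their beginnings. -/
theorem presentationPattern_readable {K : ℕ} (hK : 10 ≤ K) {f : ℕ → Bool} {c₁ c₂ c : Bool}
    (h₁ : ∀ j < K, f j = presentationPattern c₁ j)
    (h₂ : ∀ j < K, f (K + j) = presentationPattern c₂ j) {d : ℕ} (hd : d ≤ K)
    (h : ∀ t < K, f (d + t) = presentationPattern c t) : d = 0 ∨ d = K := by
  by_contra! hne
  have e (t : ℕ) (ht : t < 6) : f (d + t) = if t < 3 then c else !c := by
    rw [h t (by omega), presentationPattern]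
    split_ifs <;> rfl
  have e0 := e 0 (by omega)
  have e1 := e 1 (by omega)
  have e2 := e 2 (by omega)
  have e3 := e 3 (by omega)
  have e4 := e 4 (by omega)
  simp only [Nat.lt_irrefl, Nat.reduceLT, if_true, if_false, add_zero] at e0 e1 e2 e3 e4
  have g (j : ℕ) (h6 : 6 ≤ j) (hj : j < K) : f j = decide (j % 2 = 1) := by
    rw [h₁ j hj, presentationPattern, if_neg (by omega), if_neg (by omega)]
  have alt (j : ℕ) (h6 : 6 ≤ j) (hj : j + 1 < K) : f j ≠ f (j + 1) := by
    rw [g j h6 (by omega), g (j + 1) (by omega) hj]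
    simp only [ne_eq, decide_eq_decide]
    omega
  have p2 := h₁ 2 (by omega)
  have p3 := h₁ 3 (by omega)
  have p4 := h₁ 4 (by omega)
  have q1 := h₂ 1 (by omega)
  have q2 := h₂ 2 (by omega)
  simp only [presentationPattern, Nat.lt_irrefl, Nat.reduceLT, if_true, if_false] at p2 p3 p4 q1 q2
  -- Offsets 1 and 2 put the change of letter between places 2 and 3 inside a run `ccc`. Offsets 3
  -- to 5 put a repeated letter into the alternating part, which reaches at least place 9; so does
  -- any larger offset below `K - 1`.
  rcases Nat.lt_or_ge d 6 with h6 | h6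
  · interval_cases d
    · exact hne.1 rfl
    · simp_all
    · simp_all
    · exact alt 6 le_rfl (by omega) (e3.trans e4.symm)
    · exact alt 7 (by omega) (by omega) (e3.trans e4.symm)
    · exact alt 6 le_rfl (by omega) (e1.trans e2.symm)
  · rcases Nat.lt_or_ge (d + 1) K with hK' | hK'
    · exact alt d h6 hK' (e0.trans e1.symm)
    -- At offset `K - 1` the change of letter in `c` falls between places 1 and 2 of the second
    -- pattern, which carry equal letters.
    · obtain rfl : K = d + 1 := by omega
      rw [add_assoc] at q1 q2
      rw [e2] at q1
      rw [e3] at q2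
      rw [← q1] at q2
      simp at q2

/-- Induction on the stage. Write `d = j * q + e` with `q` the length of the subblocks. The first
subblock of the inserted word lies over two consecutive subblocks of `y`, so the induction
hypothesis forces `e = 0`. The subblocks then match one to one and `presentationPattern_readable`
determines `j`. -/
theorem presentationLetter_readable (hk : ∀ n, 10 ≤ k n) (n : ℕ) {y : ℕ → Bool}
    {c₁ c₂ c : Bool} {d : ℕ}
    (h₁ : ∀ i < presentationLength k n, y i = presentationLetter k n c₁ i)
    (h₂ : ∀ i < presentationLength k n,
      y (presentationLength k n + i) = presentationLetter k n c₂ i)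
    (hd : d ≤ presentationLength k n)
    (h : ∀ i < presentationLength k n, y (d + i) = presentationLetter k n c i) :
    d = 0 ∨ d = presentationLength k n := by
  have hk0 : ∀ n, 0 < k n := fun n => by have := hk n; omega
  induction n generalizing y c₁ c₂ c d with
  | zero => simp at hd ⊢; omega
  | succ n ih =>
    set q := presentationLength k n with hq
    have hq0 : 0 < q := presentationLength_pos hk0 n
    rw [presentationLength_succ, ← hq] at h₁ h₂ hd h ⊢
    have lt {j i : ℕ} (hj : j < k n) (hi : i < q) : j * q + i < k n * q := by
      have := Nat.mul_le_mul_right q (show j + 1 ≤ k n from hj)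
      rw [add_mul, one_mul] at this
      omega
    have b₁ (j : ℕ) (hj : j < k n) (i : ℕ) (hi : i < q) :
        y (j * q + i) = presentationLetter k n (presentationPattern c₁ j) i := by
      rw [h₁ _ (lt hj hi), presentationLetter_succ _ _ hi]
    have b₂ (j : ℕ) (hj : j < k n) (i : ℕ) (hi : i < q) :
        y ((k n + j) * q + i) = presentationLetter k n (presentationPattern c₂ j) i := by
      rw [add_mul, add_assoc, h₂ _ (lt hj hi), presentationLetter_succ _ _ hi]
    have bb (j : ℕ) (hj : j < 2 * k n) : ∃ c', ∀ i < q,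
        y (j * q + i) = presentationLetter k n c' i := by
      rcases Nat.lt_or_ge j (k n) with hj' | hj'
      · exact ⟨_, b₁ j hj'⟩
      · obtain ⟨j, rfl⟩ := Nat.exists_eq_add_of_le hj'
        exact ⟨_, b₂ j (by omega)⟩
    have b (j : ℕ) (hj : j < k n) (i : ℕ) (hi : i < q) :
        y (d + j * q + i) = presentationLetter k n (presentationPattern c j) i := by
      rw [add_assoc, h _ (lt hj hi), presentationLetter_succ _ _ hi]
    have hdm := Nat.div_add_mod d q
    have hr := Nat.mod_lt d hq0
    set j := d / q
    set e := d % q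
    rw [mul_comm] at hdm
    have hjk : j ≤ k n := Nat.le_of_mul_le_mul_right (by omega : j * q ≤ k n * q) hq0
    have he : e = 0 := by
      by_contra he
      have hj : j < k n := by
        by_contra hj
        have := Nat.mul_le_mul_right q (not_lt.1 hj)
        omega
      obtain ⟨c₁', h₁'⟩ := bb j (by omega)
      obtain ⟨c₂', h₂'⟩ := bb (j + 1) (by have := hk n; omega)
      have := ih (y := fun i => y (j * q + i)) (d := e) h₁'
        (fun i hi => by rw [← h₂' i hi, add_mul, one_mul, add_assoc]) hr.le
        (fun i hi => by
          rw [← b 0 (hk0 n) i hi, zero_mul, add_zero, ← add_assoc, hdm])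
      omega
    -- The first letter of a subblock is its type, so sampling `y` at multiples of `q` recovers the
    -- patterns.
    have key := presentationPattern_readable (hk n) (f := fun j => y (j * q)) (c₁ := c₁) (c₂ := c₂)
      (c := c) (d := j)
      (fun t ht => by simpa [presentationLetter_zero_right] using b₁ t ht 0 hq0)
      (fun t ht => by simpa [presentationLetter_zero_right] using b₂ t ht 0 hq0) hjk
      (fun t ht => by
        have := b t ht 0 hq0
        rw [presentationLetter_zero_right] at this
        rw [← this, add_mul]
        congr 1
        omega)
    rcases key with hj | hj
    · left; rw [← hdm, hj, he]; simp
    · right; rw [← hdm, hj, he]; simp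

theorem uniquelyReadable_presentationWord (hk : ∀ n, 10 ≤ k n) (n : ℕ) :
    UniquelyReadable (Set.range (presentationWord k n)) := by
  have hk0 : ∀ n, 0 < k n := fun n => by have := hk n; omega
  rintro _ ⟨c₁, rfl⟩ _ ⟨c₂, rfl⟩ _ ⟨c, rfl⟩ p s e
  simp only [presentationWord_eq_map hk0] at e
  set q := presentationLength k n with hq
  have hl := congrArg List.length e
  simp only [List.length_append, List.length_map, List.length_range] at hl
  have g (c : Bool) (i : ℕ) (hi : i < q) :
      ((List.range q).map (presentationLetter k n c)).getD i false =
        presentationLetter k n c i := by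
    simp [List.getElem?_range hi]
  -- The default value `false` is never read: all positions concerned lie inside the concatenation.
  have key := presentationLetter_readable hk n (c₁ := c₁) (c₂ := c₂) (c := c) (d := p.length)
    (y := fun i => ((List.range q).map (presentationLetter k n c₁) ++
      (List.range q).map (presentationLetter k n c₂)).getD i false)
    (fun i hi => by
      rw [List.getD_append _ _ _ _ (by simpa using hi), g _ _ hi])
    (fun i hi => by
      rw [List.getD_append_right _ _ _ _ (by simp [← hq])]; simpa [← hq] using g c₂ i hi)
    (by omega)
    (fun i hi => by
      rw [e, List.append_assoc, List.getD_append_right _ _ _ _ (by omega),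
        List.getD_append _ _ _ _ (by simpa using hi), Nat.add_sub_cancel_left, g _ _ hi])
  rcases key with h | h
  · exact Or.inl (List.length_eq_zero_iff.1 h)
  · exact Or.inr (List.length_eq_zero_iff.1 (by omega))

end Presentation

/-! ### Symbolic systems -/

section Symbolic

variable {α : Type*}

/-- Translation of a sequence by an integer, an iterate of the shift or of its inverse. -/
def shiftBy (n : ℤ) (z : ℤ → α) : ℤ → α := fun i => z (i + n)

theorem shiftBy_zero (z : ℤ → α) : shiftBy 0 z = z := by
  funext i; simp [shiftBy]

theorem shift_shiftBy (n : ℤ) (z : ℤ → α) : shift (shiftBy n z) = shiftBy (n + 1) z := by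
  funext i; simp only [shift, shiftBy]; congr 1; ring

theorem subword_shiftBy (n : ℤ) (z : ℤ → α) (m : ℤ) (l : ℕ) :
    subword (shiftBy n z) m l = subword z (m + n) l :=
  subword_eq_iff.2 fun i _ => congrArg z (by ring)

theorem mem_shift_iff_of_preimage {X : Set (ℤ → α)} (h : shift ⁻¹' X = X) (z : ℤ → α) :
    shift z ∈ X ↔ z ∈ X := Set.ext_iff.1 h z

theorem shiftBy_mem_iff {X : Set (ℤ → α)} (h : shift ⁻¹' X = X) (n : ℤ) (z : ℤ → α) :
    shiftBy n z ∈ X ↔ z ∈ X := by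
  induction n using Int.induction_on with
  | zero => rw [shiftBy_zero]
  | succ n ih => rw [← shift_shiftBy, mem_shift_iff_of_preimage h, ih]
  | pred n ih =>
    rw [← ih, ← mem_shift_iff_of_preimage h (shiftBy (-(n : ℤ) - 1) z), shift_shiftBy]
    simp

variable [TopologicalSpace α]

theorem continuous_shift : Continuous (shift : (ℤ → α) → ℤ → α) :=
  continuous_pi fun _ => continuous_apply _

theorem continuous_shiftBy (n : ℤ) : Continuous (shiftBy n : (ℤ → α) → ℤ → α) :=
  continuous_pi fun _ => continuous_apply _

theorem isOpen_subword_eq [DiscreteTopology α] (w : ℤ → α) (m m' : ℤ) (l : ℕ) :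
    IsOpen {z : ℤ → α | subword z m l = subword w m' l} := by
  have : Continuous fun (z : ℤ → α) (i : Fin l) => z (m + (i : ℕ)) :=
    continuous_pi fun _ => continuous_apply _
  have h := (isOpen_discrete {f : Fin l → α | List.ofFn f = subword w m' l}).preimage this
  exact h

/-- A sequence whose subwords all occur in a subsystem belongs to it. -/
theorem IsSymbolicSystem.mem_of_subword {X : Set (ℤ → α)} (hX : IsSymbolicSystem X) {z : ℤ → α}
    (h : ∀ (m : ℤ) (l : ℕ), ∃ y ∈ X, ∃ m' : ℤ, subword z m l = subword y m' l) : z ∈ X := by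
  -- Match the windows `[-n, n]` of `z`; the translates of `y n` that carry the match to the origin
  -- converge pointwise to `z`.
  choose y hy m' hm using fun n : ℕ => h (-n) (2 * n + 1)
  refine hX.isClosed.mem_of_tendsto (f := fun n : ℕ => shiftBy (m' n + n) (y n))
    (b := Filter.atTop) (tendsto_pi_nhds.2 fun i => ?_)
    (Filter.Eventually.of_forall fun n => (shiftBy_mem_iff hX.invariant _ _).2 (hy n))
  refine tendsto_const_nhds.congr' ?_
  filter_upwards [Filter.eventually_ge_atTop i.natAbs] with n hn
  have := subword_eq_iff.1 (hm n) (i + n).toNat (by omega)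
  rw [Int.toNat_of_nonneg (by omega)] at this
  rw [shiftBy]
  convert this using 2 <;> ring

/-- If each point contains all words of the system, every non-empty subsystem contains all words of
every point, and closedness gives back the points. -/
theorem IsSymbolicSystem.isMinimalSystem {X : Set (ℤ → α)} (hX : IsSymbolicSystem X)
    (hne : X.Nonempty)
    (h : ∀ y ∈ X, ∀ z ∈ X, ∀ (m : ℤ) (l : ℕ), ∃ m' : ℤ, subword z m l = subword y m' l) :
    IsMinimalSystem X where
  isSymbolicSystem := hX
  nonempty := hne
  eq_of_subset Y hY hYne hYX := by
    obtain ⟨y, hy⟩ := hYne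
    exact hYX.antisymm fun z hz => hY.mem_of_subword fun m l =>
      ⟨y, hy, h y (hYX hy) z hz m l⟩

theorem isSymbolicSystem_orbitClosure (x : ℤ → α) : IsSymbolicSystem (orbitClosure x) where
  isClosed := isClosed_closure
  invariant := by
    let e : (ℤ → α) ≃ₜ (ℤ → α) :=
      { toFun := shiftBy 1
        invFun := shiftBy (-1)
        left_inv := fun z => by funext i; simp [shiftBy]
        right_inv := fun z => by funext i; simp [shiftBy]
        continuous_toFun := continuous_shiftBy 1
        continuous_invFun := continuous_shiftBy (-1) }
    have he : (shift : (ℤ → α) → ℤ → α) = e := rfl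
    rw [he, orbitClosure, e.preimage_closure]
    congr 1
    ext z
    constructor
    · rintro ⟨n, hn⟩
      refine ⟨n - 1, ?_⟩
      have : z = e.symm (e z) := (e.symm_apply_apply z).symm
      rw [this, ← hn]
      funext i
      change x _ = x _
      congr 1
      ring
    · rintro ⟨n, rfl⟩
      refine ⟨n + 1, ?_⟩
      funext i
      change x _ = x _
      congr 1
      ring

theorem mem_orbitClosure (x : ℤ → α) : x ∈ orbitClosure x :=
  subset_closure ⟨0, by simp⟩

theorem exists_subword_eq_of_mem_orbitClosure [DiscreteTopology α] {x z : ℤ → α}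
    (hz : z ∈ orbitClosure x) (m : ℤ) (l : ℕ) : ∃ m' : ℤ, subword z m l = subword x m' l := by
  obtain ⟨_, h, n, rfl⟩ := mem_closure_iff.1 hz _ (isOpen_subword_eq z m m l) rfl
  exact ⟨m + n, h.symm.trans (subword_shiftBy n x m l)⟩

theorem IsMinimalSystem.exists_subword_eq [DiscreteTopology α] {X : Set (ℤ → α)}
    (hX : IsMinimalSystem X) {y z : ℤ → α} (hy : y ∈ X) (hz : z ∈ X) (m : ℤ) (l : ℕ) :
    ∃ m' : ℤ, subword z m l = subword y m' l := by
  have h : orbitClosure y = X := hX.eq_of_subset _ (isSymbolicSystem_orbitClosure y)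
    ⟨y, mem_orbitClosure y⟩ (closure_minimal
      (by rintro _ ⟨n, rfl⟩; exact (shiftBy_mem_iff hX.isSymbolicSystem.invariant n y).2 hy)
      hX.isSymbolicSystem.isClosed)
  exact exists_subword_eq_of_mem_orbitClosure (h ▸ hz) m l

/-- In a minimal system, the words of length `l` occur in all words of some length `R`. -/
theorem IsMinimalSystem.exists_subword_isInfix [Finite α] [DiscreteTopology α] {X : Set (ℤ → α)}
    (hX : IsMinimalSystem X) (l : ℕ) :
    ∃ R : ℕ, ∀ r ≥ R, ∀ z ∈ X, ∀ z' ∈ X, ∀ m m' : ℤ, subword z m l <:+: subword z' m' r := by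
  have key (f : Fin l → α) : ∃ R : ℕ, ∀ z ∈ X, (∀ i : Fin l, z (i : ℕ) = f i) → ∀ z' ∈ X,
      subword z 0 l <:+: subword z' 0 R := by
    by_cases hf : ∃ z ∈ X, ∀ i : Fin l, z (i : ℕ) = f i
    · obtain ⟨z, hz, hzf⟩ := hf
      obtain ⟨t, ht⟩ := hX.isSymbolicSystem.isClosed.isCompact.elim_finite_subcover
        (fun j : ℤ => {z' : ℤ → α | subword z' j l = subword z 0 l})
        (fun j => isOpen_subword_eq z j 0 l)
        (fun z' hz' => by
          obtain ⟨j, hj⟩ := hX.exists_subword_eq hz' hz 0 l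
          exact Set.mem_iUnion.2 ⟨j, hj.symm⟩)
      set M := t.sup Int.natAbs
      -- By compactness the word starts at some position in `[-M, M]` of every point; translation by
      -- `M` moves this range to `[0, 2 * M]`.
      refine ⟨2 * M + l, fun z₁ _ hz₁f z' hz' => ?_⟩
      have hM := ht ((shiftBy_mem_iff hX.isSymbolicSystem.invariant M z').2 hz')
      simp only [Set.mem_iUnion, Set.mem_ofPred_eq] at hM
      obtain ⟨j, hj, e⟩ := hM
      have hjM : j.natAbs ≤ M := Finset.le_sup (f := Int.natAbs) hj
      refine subword_isInfix_iff.2 ⟨(M + j).toNat, by omega, fun i hi => ?_⟩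
      have := subword_eq_iff.1 e i hi
      rw [zero_add] at this ⊢
      rw [hz₁f ⟨i, hi⟩, ← hzf ⟨i, hi⟩, ← this, shiftBy]
      congr 1
      omega
    · push Not at hf
      exact ⟨0, fun z hz h => by obtain ⟨i, hi⟩ := hf z hz; exact absurd (h i) hi⟩
  choose R hR using key
  -- There are finitely many words of length `l`, so one bound serves all of them.
  obtain ⟨R₀, hR₀⟩ := (Set.finite_range R).bddAbove
  refine ⟨R₀, fun r hr z hz z' hz' m m' => ?_⟩
  have h := hR (fun i => z ((i : ℕ) + m)) (shiftBy m z)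
    ((shiftBy_mem_iff hX.isSymbolicSystem.invariant m z).2 hz) (fun i => rfl) (shiftBy m' z')
    ((shiftBy_mem_iff hX.isSymbolicSystem.invariant m' z').2 hz')
  rw [subword_shiftBy, subword_shiftBy, zero_add, zero_add] at h
  obtain ⟨d, hd, h⟩ := subword_isInfix_iff.1 h
  exact subword_isInfix_iff.2
    ⟨d, hd.trans ((hR₀ (Set.mem_range_self _)).trans hr), h⟩

/-- Every non-empty symbolic system over a finite alphabet has a minimal subsystem. -/
theorem IsSymbolicSystem.exists_isMinimalSystem [Finite α] [DiscreteTopology α]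
    {X : Set (ℤ → α)} (hX : IsSymbolicSystem X) (hne : X.Nonempty) :
    ∃ Y ⊆ X, IsMinimalSystem Y := by
  obtain ⟨Y, hY⟩ := zorn_superset {Y | IsSymbolicSystem Y ∧ Y.Nonempty ∧ Y ⊆ X} (by
    intro c hc hchain
    rcases c.eq_empty_or_nonempty with rfl | hcne
    · exact ⟨X, ⟨hX, hne, subset_rfl⟩, by simp⟩
    · refine ⟨⋂₀ c, ⟨⟨isClosed_sInter fun Y hY => (hc hY).1.isClosed, ?_⟩, ?_, ?_⟩,
        fun s hs => Set.sInter_subset_of_mem hs⟩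
      · rw [Set.sInter_eq_biInter, Set.preimage_iInter₂]
        exact Set.iInter₂_congr fun Y hY => (hc hY).1.invariant
      · have := hcne.to_subtype
        exact IsCompact.nonempty_sInter_of_directed_nonempty_isCompact_isClosed
          (fun Y hY Z hZ => (hchain.total hY hZ).elim (fun h => ⟨Y, hY, subset_rfl, h⟩)
            fun h => ⟨Z, hZ, h, subset_rfl⟩) (fun Y hY => (hc hY).2.1)
          (fun Y hY => (hc hY).1.isClosed.isCompact) (fun Y hY => (hc hY).1.isClosed)
      · obtain ⟨Y, hY⟩ := hcne
        exact (Set.sInter_subset_of_mem hY).trans (hc hY).2.2)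
  refine ⟨Y, hY.prop.2.2, hY.prop.1, hY.prop.2.1, fun Z hZ hZne hZY => ?_⟩
  exact hZY.antisymm (hY.le_of_le ⟨hZ, hZne, hZY.trans hY.prop.2.2⟩ hZY)

theorem isSymbolicSystem_limitSystem [DiscreteTopology α] (W : ℕ → Set (List α)) :
    IsSymbolicSystem (limitSystem W) where
  isClosed := by
    simp only [limitSystem, Set.ofPred_forall]
    refine isClosed_iInter fun m => isClosed_iInter fun l => ⟨?_⟩
    refine isOpen_iff_forall_mem_open.2 fun z hz =>
      ⟨_, fun z' hz' => ?_, isOpen_subword_eq z m m l, rfl⟩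
    rw [Set.mem_ofPred_eq] at hz'
    rwa [Set.mem_compl_iff, Set.mem_ofPred_eq, hz']
  invariant := by
    ext z
    have h (m : ℤ) (l : ℕ) : subword (shift z) m l = subword z (m + 1) l :=
      subword_shiftBy 1 z m l
    simp only [limitSystem, Set.mem_preimage, Set.mem_ofPred_eq, h]
    exact ⟨fun H m l => by simpa using H (m - 1) l, fun H m l => H (m + 1) l⟩

/-- The orbit closure of a Toeplitz sequence is minimal. -/
theorem IsToeplitz.isMinimalSystem [DiscreteTopology α] {x : ℤ → α} (hx : IsToeplitz x) :
    IsMinimalSystem (orbitClosure x) := by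
  choose p hp hxp using hx
  refine (isSymbolicSystem_orbitClosure x).isMinimalSystem ⟨x, mem_orbitClosure x⟩
    fun y hy z hz m l => ?_
  obtain ⟨m', hm'⟩ := exists_subword_eq_of_mem_orbitClosure hz m l
  -- A common period of all positions in the window: the word recurs in `x` along `m' + P * ℤ`.
  set P := ∏ i ∈ Finset.range l, p (m' + i) with hP
  have hP0 : 0 < P := Finset.prod_pos fun i _ => hp _
  have hper (i : ℕ) (hi : i < l) (j : ℤ) : x (m' + i + P * j) = x (m' + i) := by
    obtain ⟨t, ht⟩ := Finset.dvd_prod_of_mem (fun i : ℕ => p (m' + i)) (Finset.mem_range.2 hi)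
    rw [← hP] at ht
    rw [← hxp (m' + i) (t * j), ht]
    push_cast
    congr 1
    ring
  -- A window of length `P + l` contains a full occurrence, since it has a starting place in each
  -- residue class modulo `P`.
  obtain ⟨s, hs⟩ := exists_subword_eq_of_mem_orbitClosure hy 0 (P + l)
  set e := (m' - s) % P
  have he0 : 0 ≤ e := Int.emod_nonneg _ (by omega)
  have heP : e < P := Int.emod_lt_of_pos _ (by omega)
  have he : m' - s = P * ((m' - s) / P) + e := (Int.mul_ediv_add_emod _ _).symm
  refine ⟨e, hm'.trans (subword_eq_iff.2 fun i hi => ?_)⟩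
  have h := subword_eq_iff.1 hs (e.toNat + i) (by omega)
  rw [Nat.cast_add, Int.toNat_of_nonneg he0, zero_add] at h
  rw [h, ← hper i hi (-((m' - s) / P))]
  congr 1
  linarith

end Symbolic

/-! ### Alignment with the blocks of the presentation -/

section Aligned

variable {k : ℕ → ℕ}

/-- `y` is a concatenation of the words `aₙ`, `bₙ`, and the position `0` is the position `r` of the
word that contains it. -/
def IsAligned (k : ℕ → ℕ) (n : ℕ) (r : ZMod (presentationLength k n)) (y : ℤ → Bool) : Prop :=
  ∀ m : ℤ, (m : ZMod (presentationLength k n)) + r = 0 →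
    ∃ c, ∀ i : ℕ, i < presentationLength k n → y (m + i) = presentationLetter k n c i

theorem isAligned_shift {n : ℕ} {r : ZMod (presentationLength k n)} {y : ℤ → Bool} :
    IsAligned k n (r + 1) (shift y) ↔ IsAligned k n r y := by
  constructor
  · intro h m hm
    obtain ⟨c, hc⟩ := h (m - 1) (by rw [← hm]; push_cast; ring)
    refine ⟨c, fun i hi => ?_⟩
    rw [← hc i hi, shift]
    congr 1
    ring
  · intro h m hm
    obtain ⟨c, hc⟩ := h (m + 1) (by rw [← hm]; push_cast; ring)
    refine ⟨c, fun i hi => ?_⟩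
    rw [← hc i hi, shift]
    congr 1
    ring

/-- The block that contains a given position. -/
theorem IsAligned.exists_block (hk : ∀ n, 0 < k n) {n : ℕ} {r : ZMod (presentationLength k n)}
    {y : ℤ → Bool} (h : IsAligned k n r y) (m : ℤ) :
    ((m - ((m : ZMod (presentationLength k n)) + r).val : ℤ) : ZMod (presentationLength k n)) + r
        = 0 ∧
      ((m : ZMod (presentationLength k n)) + r).val < presentationLength k n ∧
      ∃ c, ∀ i : ℕ, i < presentationLength k n →
        y (m - ((m : ZMod (presentationLength k n)) + r).val + i) = presentationLetter k n c i := by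
  have : NeZero (presentationLength k n) := ⟨(presentationLength_pos hk n).ne'⟩
  have h0 : ((m - ((m : ZMod (presentationLength k n)) + r).val : ℤ) :
      ZMod (presentationLength k n)) + r = 0 := by
    push_cast
    rw [ZMod.natCast_zmod_val]
    ring
  exact ⟨h0, ZMod.val_lt _, h _ h0⟩

/-- Long blocks are concatenations of short ones, and the boundaries of short blocks are the places
whose offset in the long block is divisible by the short length. -/
theorem IsAligned.of_le (hk : ∀ n, 0 < k n) {m n : ℕ} (hmn : m ≤ n)
    {r : ZMod (presentationLength k n)} {y : ℤ → Bool} (h : IsAligned k n r y) :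
    IsAligned k m (ZMod.castHom (presentationLength_dvd hmn) _ r) y := by
  intro s hs
  have : NeZero (presentationLength k n) := ⟨(presentationLength_pos hk n).ne'⟩
  obtain ⟨-, hlt, c, hc⟩ := h.exists_block hk s
  set t := ((s : ZMod (presentationLength k n)) + r).val with ht
  have hdvd : presentationLength k m ∣ t := by
    rw [← ZMod.natCast_eq_zero_iff, ← hs]
    have := congrArg (ZMod.castHom (presentationLength_dvd hmn) (ZMod (presentationLength k m)))
      (ZMod.natCast_zmod_val ((s : ZMod (presentationLength k n)) + r))
    rw [← ht, map_add, map_natCast, map_intCast] at this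
    exact this
  obtain ⟨j, hj⟩ := hdvd
  rw [mul_comm] at hj
  obtain ⟨c', hc'⟩ := exists_presentationLetter_eq hk hmn c j (by omega)
  refine ⟨c', fun i hi => ?_⟩
  have hi' : j * presentationLength k m + i < presentationLength k n := by
    obtain ⟨u, hu⟩ := presentationLength_dvd (k := k) hmn
    rw [hu, mul_comm _ u] at hlt ⊢
    rw [hj] at hlt
    have := Nat.mul_le_mul_right (presentationLength k m) (show j + 1 ≤ u from
      Nat.lt_of_mul_lt_mul_right hlt)
    rw [add_mul, one_mul] at this
    omega
  rw [← hc' i hi, ← hc _ hi', hj]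
  congr 1
  push_cast
  ring

/-- A periodic repetition of `aₙ`, suitably translated, is a witness. -/
theorem exists_isAligned (hk : ∀ n, 0 < k n) (n : ℕ) (r : ZMod (presentationLength k n)) :
    ∃ y, IsAligned k n r y := by
  have : NeZero (presentationLength k n) := ⟨(presentationLength_pos hk n).ne'⟩
  refine ⟨fun m => presentationLetter k n false ((m : ZMod (presentationLength k n)) + r).val,
    fun m hm => ⟨false, fun i hi => ?_⟩⟩
  have : ((m + i : ℤ) : ZMod (presentationLength k n)) + r = (i : ℕ) := by
    push_cast
    rw [add_right_comm, hm, zero_add]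
  simp only [this, ZMod.val_cast_of_lt hi]

theorem isClosed_isAligned (n : ℕ) (r : ZMod (presentationLength k n)) :
    IsClosed {y | IsAligned k n r y} := by
  simp only [IsAligned, Set.ofPred_forall]
  refine isClosed_iInter fun m => isClosed_iInter fun _ => ?_
  have (c : Bool) : {y : ℤ → Bool | ∀ i : ℕ, i < presentationLength k n →
      y (m + i) = presentationLetter k n c i} = ⋂ (i : ℕ) (_ : i < presentationLength k n),
      {y | y (m + i) = presentationLetter k n c i} := by
    ext; simp
  simp only [Set.ofPred_exists]
  refine isClosed_iUnion_of_finite fun c => ?_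
  rw [this]
  exact isClosed_iInter fun i => isClosed_iInter fun _ =>
    isClosed_eq (continuous_apply _) continuous_const

/-- A sequence that is aligned at all stages belongs to the presentation. -/
theorem mem_odometerPresentation (hk : ∀ n, 10 ≤ k n) {y : ℤ → Bool}
    (h : ∀ n, ∃ r, IsAligned k n r y) : y ∈ odometerPresentation k := by
  have hk0 : ∀ n, 0 < k n := fun n => by have := hk n; omega
  intro m l
  -- At stage `l` the blocks have length at least `l`, so a window of length `l` meets at most two
  -- consecutive blocks.
  have hl : l ≤ presentationLength k l :=
    Nat.lt_two_pow_self.le.trans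
      (two_pow_le_presentationLength (fun n => by have := hk n; omega) l)
  set q := presentationLength k l with hq
  obtain ⟨r, hr⟩ := h l
  obtain ⟨h0, ht, c₁, hc₁⟩ := hr.exists_block hk0 m
  set t := ((m : ZMod (presentationLength k l)) + r).val
  obtain ⟨c₂, hc₂⟩ := hr (m - t + q) (by rw [← h0]; push_cast; rw [hq]; simp)
  -- All four pairs of letters occur consecutively among the first ten letters of the pattern, so
  -- any two adjacent blocks already occur inside the next `a` word.
  obtain ⟨j, hj, hj₁, hj₂⟩ : ∃ j < 9, presentationPattern false j = c₁ ∧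
      presentationPattern false (j + 1) = c₂ := by
    revert c₁ c₂
    have : ∀ c₁ c₂, ∃ j < 9, presentationPattern false j = c₁ ∧
      presentationPattern false (j + 1) = c₂ := by decide
    exact fun c₁ _ c₂ _ => this c₁ c₂
  refine ⟨l + 1, _, ⟨false, rfl⟩, ?_⟩
  rw [presentationWord_eq_subword hk0, subword_isInfix_iff]
  have hK := Nat.mul_le_mul_right q (show j + 1 + 1 ≤ k l by have := hk l; omega)
  simp only [add_mul, one_mul] at hK
  refine ⟨j * q + t, by rw [presentationLength_succ, ← hq]; omega, fun i hi => ?_⟩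
  have e : (0 + ((j * q + t : ℕ) : ℤ) + i).toNat = j * q + (t + i) := by omega
  rw [e]
  rcases Nat.lt_or_ge (t + i) q with hlt | hge
  · rw [presentationLetter_succ _ _ hlt, hj₁, ← hc₁ _ hlt]
    congr 1
    push_cast
    ring
  · obtain ⟨u, hu⟩ := Nat.exists_eq_add_of_le hge
    have hu' : u < q := by omega
    have e' : j * q + (t + i) = (j + 1) * q + u := by rw [hu]; ring
    rw [e', presentationLetter_succ _ _ hu', hj₂, ← hc₂ u hu']
    congr 1
    have : (t : ℤ) + i = q + u := by exact_mod_cast hu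
    linarith

/-- The fibre of the presentation over a compatible sequence of positions is non-empty. -/
theorem exists_forall_isAligned (hk : ∀ n, 0 < k n) (r : ∀ n, ZMod (presentationLength k n))
    (hr : ∀ n, ZMod.castHom (presentationLength_dvd n.le_succ) _ (r (n + 1)) = r n) :
    ∃ y, ∀ n, IsAligned k n (r n) y := by
  obtain ⟨y, hy⟩ := IsCompact.nonempty_iInter_of_sequence_nonempty_isCompact_isClosed
    (fun n => {y | IsAligned k n (r n) y})
    (fun n y hy => by have := IsAligned.of_le hk n.le_succ hy; rwa [hr] at this)
    (fun n => exists_isAligned hk n _) (isClosed_isAligned _ _).isCompact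
    fun n => isClosed_isAligned _ _
  exact ⟨y, fun n => Set.mem_iInter.1 hy n⟩

theorem exists_presentationLetter_succ (hk : ∀ n, 10 ≤ k n) (n : ℕ) (c c' : Bool) :
    ∃ d, d + presentationLength k n ≤ presentationLength k (n + 1) ∧
      ∀ i < presentationLength k n,
        presentationLetter k (n + 1) c (d + i) = presentationLetter k n c' i := by
  obtain ⟨j, hj, hjc⟩ : ∃ j < 9, presentationPattern c j = c' := by
    revert c c'; decide
  have := Nat.mul_le_mul_right (presentationLength k n) (show j + 1 ≤ k n by have := hk n; omega)
  rw [add_mul, one_mul] at this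
  exact ⟨j * presentationLength k n, by rwa [presentationLength_succ], fun i hi => by
    rw [presentationLetter_succ _ _ hi, hjc]⟩

/-- A word of the system lies in some word of stage `n`, hence in both words of stage `n + 1`. Any
window of length `2 * q` of any point, with `q` the length at stage `n + 1`, contains a complete
block of that stage. -/
theorem isMinimalSystem_odometerPresentation (hk : ∀ n, 10 ≤ k n) :
    IsMinimalSystem (odometerPresentation k) := by
  have hk0 : ∀ n, 0 < k n := fun n => by have := hk n; omega
  refine (isSymbolicSystem_limitSystem _).isMinimalSystem ?_ fun y hy z hz m l => ?_
  · obtain ⟨y, hy⟩ := exists_forall_isAligned hk0 (fun n => 0) fun n => map_zero _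
    exact ⟨y, mem_odometerPresentation hk fun n => ⟨_, hy n⟩⟩
  · obtain ⟨n, _, ⟨c, rfl⟩, hn⟩ := hz m l
    rw [presentationWord_eq_subword hk0, subword_isInfix_iff] at hn
    obtain ⟨d, hd, hz⟩ := hn
    set q := presentationLength k (n + 1) with hq
    have hq0 : 0 < q := presentationLength_pos hk0 _
    obtain ⟨N, _, ⟨c', rfl⟩, hN⟩ := hy 0 (2 * q)
    rw [presentationWord_eq_subword hk0, subword_isInfix_iff] at hN
    obtain ⟨s, hs, hy⟩ := hN
    have hnN : n + 1 ≤ N := by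
      by_contra hlt
      have := Nat.le_of_dvd hq0 (presentationLength_dvd (k := k) (not_le.1 hlt).le)
      omega
    have hsm := Nat.div_add_mod s q
    have hr := Nat.mod_lt s hq0
    set j := s / q
    set e := s % q
    have hjq : (j + 1) * q = q * j + q := by ring
    obtain ⟨c'', hc''⟩ := exists_presentationLetter_eq hk0 hnN c' (j + 1) (by rw [← hq]; omega)
    rw [← hq, hjq] at hc''
    obtain ⟨f, hf, hfc⟩ := exists_presentationLetter_succ hk n c'' c
    refine ⟨(q - e + f + d : ℕ), subword_eq_iff.2 fun i hi => ?_⟩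
    have h1 := hy (q - e + f + d + i) (by omega)
    have e1 : (0 + (s : ℤ) + (q - e + f + d + i : ℕ)).toNat = q * j + q + (f + (d + i)) := by
      omega
    rw [e1, hc'' _ (by omega), hfc _ (by omega), zero_add] at h1
    rw [hz i hi, show (0 + (d : ℤ) + i).toNat = d + i by omega, ← h1]
    congr 1

end Aligned

/-! ### Block positions -/

/-- `φ n x` is the position of `0` in a block of length `presentationLength k n` of `x`. -/
structure IsBlockPosition {α : Type*} [TopologicalSpace α] (k : ℕ → ℕ) (X : Set (ℤ → α))
    (φ : ∀ n, (ℤ → α) → ZMod (presentationLength k n)) : Prop where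
  continuousOn : ∀ n, ContinuousOn (φ n) X
  map_shift : ∀ n, ∀ x ∈ X, φ n (shift x) = φ n x + 1
  castHom_eq : ∀ {m n : ℕ} (h : m ≤ n) (x : ℤ → α),
    ZMod.castHom (presentationLength_dvd h) _ (φ n x) = φ m x

section Odometer

variable {k : ℕ → ℕ}

/-- The number with the first `n` digits of `o`. -/
def odometerValue (k : ℕ → ℕ) (n : ℕ) (o : OdometerSpace k) : ℕ :=
  ∑ i ∈ Finset.range n, (o i).val * presentationLength k i

theorem odometerValue_succ (n : ℕ) (o : OdometerSpace k) :
    odometerValue k (n + 1) o = odometerValue k n o + (o n).val * presentationLength k n :=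
  Finset.sum_range_succ _ _

theorem ZMod.val_neg_one_add_one {K : ℕ} (hK : 2 ≤ K) : (-1 : ZMod K).val + 1 = K := by
  obtain ⟨K, rfl⟩ := Nat.exists_eq_add_of_le' (show 1 ≤ K by omega)
  rw [ZMod.val_neg_one]

theorem ZMod.val_add_one_of_ne_neg_one {K : ℕ} (hK : 2 ≤ K) {a : ZMod K} (ha : a ≠ -1) :
    (a + 1).val = a.val + 1 := by
  have : NeZero K := ⟨by omega⟩
  have : Fact (1 < K) := ⟨hK⟩
  have h1 := ZMod.val_one K
  rw [ZMod.val_add_of_lt, h1]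
  rw [h1]
  refine lt_of_le_of_ne (ZMod.val_lt a) fun h => ha ?_
  apply ZMod.val_injective
  have := ZMod.val_neg_one_add_one hK
  omega

/-- On the first `n` digits the carry is addition of one modulo the block length. The case split
isolates the wrap-around, when all these digits are maximal and the carry leaves them. -/
theorem odometerValue_odometer (hk : ∀ n, 2 ≤ k n) (n : ℕ) (o : OdometerSpace k) :
    ((∀ i < n, o i = -1) → odometerValue k n o + 1 = presentationLength k n ∧
      odometerValue k n (odometer k o) = 0) ∧
    ((¬ ∀ i < n, o i = -1) →
      odometerValue k n (odometer k o) = odometerValue k n o + 1) := by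
  induction n with
  | zero => simp [odometerValue]
  | succ n ih =>
    rw [odometerValue_succ, odometerValue_succ, presentationLength_succ]
    by_cases h : ∀ i < n, o i = -1
    · obtain ⟨h1, h2⟩ := ih.1 h
      have e : odometer k o n = o n + 1 := by rw [odometer, if_pos h]
      rw [e, h2]
      by_cases hn : o n = -1
      · refine ⟨fun _ => ?_, fun H => absurd (fun i hi => ?_) H⟩
        · rw [hn]
          refine ⟨?_, by simp⟩
          have := congrArg (· * presentationLength k n) (ZMod.val_neg_one_add_one (hk n))
          simp only [add_mul, one_mul] at this
          omega
        · rcases Nat.lt_succ_iff_lt_or_eq.1 hi with hi | rfl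
          exacts [h i hi, hn]
      · refine ⟨fun H => absurd (H n n.lt_succ_self) hn, fun _ => ?_⟩
        rw [ZMod.val_add_one_of_ne_neg_one (hk n) hn, add_mul, one_mul, ← h1]
        ring
    · have e : odometer k o n = o n := by rw [odometer, if_neg h]
      rw [e, ih.2 h]
      exact ⟨fun H => absurd (fun i hi => H i (by omega)) h, fun _ => by ring⟩

theorem IsOdometerFactor.isBlockPosition {α : Type*} [TopologicalSpace α] {X : Set (ℤ → α)}
    {π : (ℤ → α) → OdometerSpace k} (h : IsOdometerFactor X k π) :
    IsBlockPosition k X fun n x => (odometerValue k n (π x) : ZMod (presentationLength k n)) where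
  continuousOn n := by
    have h1 : Continuous fun o : OdometerSpace k => odometerValue k n o :=
      continuous_finsetSum _ fun i _ => Continuous.mul
        (continuous_of_discreteTopology.comp (continuous_apply i)) continuous_const
    exact ((continuous_of_discreteTopology (f := fun t : ℕ => (t : ZMod (presentationLength k n)))
      ).comp h1).comp_continuousOn h.continuousOn
  map_shift n x hx := by
    obtain ⟨h1, h2⟩ := odometerValue_odometer h.two_le n (π x)
    rw [h.map_shift x hx]
    by_cases H : ∀ i < n, π x i = -1
    · have := congrArg (Nat.cast (R := ZMod (presentationLength k n))) (h1 H).1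
      rw [(h1 H).2]
      push_cast at this ⊢
      rw [this, ZMod.natCast_self]
    · rw [h2 H]
      push_cast
      rfl
  castHom_eq {m n} hmn x := by
    rw [map_natCast]
    induction n, hmn using Nat.le_induction with
    | base => rfl
    | succ n hmn ih =>
      rw [odometerValue_succ, Nat.cast_add, ih, Nat.cast_mul,
        (ZMod.natCast_eq_zero_iff _ _).2 (presentationLength_dvd hmn), mul_zero, add_zero]

end Odometer

/-! ### Odometer based presentations of minimal systems -/

/-- A concatenation of words of a common length has only one parsing without spacers. -/
theorem existsUnique_parsing {β : Type*} {W : Set (List β)} {q q' : ℕ} (hq : 0 < q) (hq' : 0 < q')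
    (hW : ∀ v ∈ W, v.length = q) {ws : List (List β)} (hne : ws ≠ []) (hws : ∀ v ∈ ws, v ∈ W) :
    ∃! P : List (List β × List β) × List β,
      IsParsing W ws.flatten P ∧ (spacerLength P : ℝ) / q' < 1 / q' := by
  have hq'0 : (0 : ℝ) < q' := by exact_mod_cast hq'
  have replicate {L : List (List β)} (hL : ∀ v ∈ L, v ∈ W) :
      L.map List.length = List.replicate L.length q :=
    List.eq_replicate_iff.2 ⟨by simp, fun b hb => by
      obtain ⟨v, hv, rfl⟩ := List.mem_map.1 hb
      exact hW v (hL v hv)⟩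
  refine ⟨(ws.map fun w => ([], w), []), ⟨⟨by simpa using hne, ?_, ?_⟩, ?_⟩, ?_⟩
  · intro b hb
    obtain ⟨w, hw, rfl⟩ := List.mem_map.1 hb
    exact hws w hw
  · simp [List.flatMap_def, Function.comp_def]
  · have : spacerLength (ws.map fun w => (([] : List β), w), ([] : List β)) = 0 := by
      simp [spacerLength, Function.comp_def]
    rw [this]
    simpa using hq'
  · rintro ⟨L, u⟩ ⟨⟨-, hL, hflat⟩, hlt⟩
    -- The threshold `1 / q'` means less than one spacer letter, hence none.
    rw [div_lt_div_iff_of_pos_right hq'0] at hlt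
    have h0 : spacerLength (L, u) = 0 := by
      have : spacerLength (L, u) < 1 := by exact_mod_cast hlt
      omega
    simp only [spacerLength, Nat.add_eq_zero_iff, List.sum_eq_zero_iff, List.mem_map,
      forall_exists_index, and_imp, forall_apply_eq_imp_iff₂, List.length_eq_zero_iff] at h0
    obtain ⟨hnil, rfl⟩ := h0
    have hLmap : L = (L.map Prod.snd).map fun w => ([], w) := by
      rw [List.map_map]
      conv_lhs => rw [← List.map_id L]
      refine List.map_congr_left fun b hb => ?_
      exact Prod.ext (hnil b hb) rfl
    have hmem : ∀ v ∈ L.map Prod.snd, v ∈ W := fun v hv => by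
      obtain ⟨b, hb, rfl⟩ := List.mem_map.1 hv
      exact hL b hb
    have hfl : (L.map Prod.snd).flatten = ws.flatten := by
      rw [← hflat, hLmap]
      simp [List.flatMap_def, Function.comp_def]
    have hlen : (L.map Prod.snd).length = ws.length := by
      have := congrArg List.length hfl
      rw [List.length_flatten, List.length_flatten, replicate hmem, replicate hws,
        List.sum_replicate, List.sum_replicate, smul_eq_mul, smul_eq_mul] at this
      exact Nat.eq_of_mul_eq_mul_right hq this
    have : L.map Prod.snd = ws := List.eq_iff_flatten_eq.2
      ⟨hfl, by rw [replicate hmem, replicate hws, hlen]⟩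
    rw [hLmap, this]

section OdometerBased

variable {k : ℕ → ℕ} {β : Type*} [TopologicalSpace β] {X : Set (ℤ → β)}
  {ψ : ∀ n, (ℤ → β) → ZMod (presentationLength k n)}

theorem IsBlockPosition.map_shiftBy (hψ : IsBlockPosition k X ψ) (hX : shift ⁻¹' X = X) (n : ℕ)
    {z : ℤ → β} (hz : z ∈ X) (m : ℤ) : ψ n (shiftBy m z) = ψ n z + m := by
  induction m using Int.induction_on with
  | zero => simp [shiftBy_zero]
  | succ m ih =>
    rw [← shift_shiftBy, hψ.map_shift n _ ((shiftBy_mem_iff hX _ _).2 hz), ih]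
    push_cast
    ring
  | pred m ih =>
    have h := hψ.map_shift n _ ((shiftBy_mem_iff hX (-(m : ℤ) - 1) z).2 hz)
    rw [shift_shiftBy, sub_add_cancel, ih] at h
    rw [← sub_eq_iff_eq_add.2 h]
    push_cast
    ring

/-- The words of the blocks of stage `n` in the sequences of `X`. -/
def blockWords (k : ℕ → ℕ) (X : Set (ℤ → β)) (ψ : ∀ n, (ℤ → β) → ZMod (presentationLength k n))
    (n : ℕ) : Set (List β) :=
  {w | ∃ z ∈ X, ψ n z = 0 ∧ w = subword z 0 (presentationLength k n)}

/-- Blocks split into blocks of earlier stages, which gives the parsings. Only the occurrence of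
each word in each later word needs minimality: the stages `e n` are chosen so sparse that a block of
stage `e (n + 1)` is longer than the recurrence bound for blocks of stage `e n`. -/
theorem IsMinimalSystem.isOdometerBased [Finite β] [DiscreteTopology β] (hX : IsMinimalSystem X)
    (hk : ∀ n, 2 ≤ k n) (hψ : IsBlockPosition k X ψ)
    (hread : ∀ n, UniquelyReadable (blockWords k X ψ n)) : IsOdometerBased X := by
  have hinv := hX.isSymbolicSystem.invariant
  have hk0 : ∀ n, 0 < k n := fun n => by have := hk n; omega
  have hpos := presentationLength_pos hk0
  have hpow (n : ℕ) := two_pow_le_presentationLength hk n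
  choose R hR using hX.exists_subword_isInfix
  -- A stage number at least `R` suffices, as the length at stage `n` is at least `2 ^ n`; the term
  -- `n + 1` makes `e` strictly increasing.
  let g : ℕ → ℕ := fun n => max (n + 1) (R (presentationLength k n))
  let e : ℕ → ℕ := fun n => g^[n] 0
  have he (n : ℕ) : e (n + 1) = g (e n) := Function.iterate_succ_apply' g n 0
  have hlt (n : ℕ) : e n < e (n + 1) := by
    rw [he]; exact lt_of_lt_of_le (Nat.lt_succ_self _) (le_max_left _ _)
  have hmono : StrictMono e := strictMono_nat_of_lt_succ hlt
  have hRe (n : ℕ) : R (presentationLength k (e n)) ≤ presentationLength k (e (n + 1)) := by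
    refine le_trans ?_ (Nat.lt_two_pow_self.le.trans (hpow _))
    rw [he]
    exact le_max_right _ _
  have hdvd (n : ℕ) := presentationLength_dvd (k := k) (hlt n).le
  have hsplit (n : ℕ) : ∀ w ∈ blockWords k X ψ (e (n + 1)), ∃ ws : List (List β),
      ws.length = presentationLength k (e (n + 1)) / presentationLength k (e n) ∧
      (∀ v ∈ ws, v ∈ blockWords k X ψ (e n)) ∧ ws.flatten = w := by
    rintro _ ⟨z, hz, h0, rfl⟩
    refine ⟨_, ?_, ?_, (flatten_subwords z 0 _ (presentationLength k (e n))).trans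
      (by rw [Nat.div_mul_cancel (hdvd n)])⟩
    · rw [List.length_map, List.length_range]
    · intro v hv
      obtain ⟨j, -, rfl⟩ := List.mem_map.1 hv
      refine ⟨shiftBy (j * presentationLength k (e n) : ℕ) z, (shiftBy_mem_iff hinv _ _).2 hz, ?_,
        (subword_shiftBy _ _ _ _).symm⟩
      rw [hψ.map_shiftBy hinv _ hz, ← hψ.castHom_eq (hlt n).le, h0]
      simp
  have hquot (n : ℕ) :
      2 ≤ presentationLength k (e (n + 1)) / presentationLength k (e n) :=
    (Nat.le_div_iff_mul_le (hpos _)).2 (two_mul_presentationLength_le hk (hlt n))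
  have hlen (n : ℕ) : ∀ w ∈ blockWords k X ψ n, w.length = presentationLength k n := by
    rintro _ ⟨z, -, -, rfl⟩
    exact length_subword _ _ _
  refine ⟨{s | [s] ∈ blockWords k X ψ 0}, fun n => presentationLength k (e n),
    fun n => presentationLength k (e (n + 1)) / presentationLength k (e n),
    fun n => blockWords k X ψ (e n), ⟨Set.toFinite _, fun n => ?_, ?_, fun n => hlen _,
      fun n => hread _, ?_, ?_⟩, hquot, hsplit, ?_⟩
  · obtain ⟨z, hz⟩ := hX.nonempty
    have : NeZero (presentationLength k (e n)) := ⟨(hpos _).ne'⟩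
    refine ⟨_, shiftBy (-(ψ (e n) z).val : ℤ) z, (shiftBy_mem_iff hinv _ _).2 hz, ?_, rfl⟩
    rw [hψ.map_shiftBy hinv _ hz]
    simp
  · ext w
    constructor
    · intro hw
      have h1 := hlen _ w hw
      obtain ⟨s, rfl⟩ := List.length_eq_one_iff.1 (h1.trans presentationLength_zero)
      exact ⟨s, hw, rfl⟩
    · rintro ⟨s, hs, rfl⟩
      exact hs
  · rintro n _ ⟨z, hz, -, rfl⟩ _ ⟨z', hz', -, rfl⟩
    exact hR _ _ (hRe n) z hz z' hz' 0 0
  -- This tolerance excludes spacers and is summable because block lengths grow at least like `2 ^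
  -- n`.
  · refine ⟨fun n => 1 / (presentationLength k (e n) : ℝ), ?_, fun n => ?_, fun n w hw => ?_⟩
    · refine Summable.of_nonneg_of_le (fun n => by positivity) (fun n => ?_)
        summable_geometric_two
      rw [one_div_pow]
      refine one_div_le_one_div_of_le (by positivity) ?_
      exact_mod_cast (Nat.pow_le_pow_right (by omega) (hmono.le_apply (x := n))).trans (hpow _)
    · have := hpos (e n)
      positivity
    · obtain ⟨ws, hl, hws, rfl⟩ := hsplit n w hw
      refine existsUnique_parsing (hpos (e n)) (hpos _) (hlen _) (fun h => ?_) hws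
      have := hquot n
      rw [← hl, h] at this
      simp at this
  · ext z
    constructor
    · intro hz m l
      obtain ⟨y, hy⟩ := hX.nonempty
      set N := R l
      have hN : R l ≤ presentationLength k (e N) :=
        (hmono.le_apply (x := R l)).trans (Nat.lt_two_pow_self.le.trans (hpow _))
      have : NeZero (presentationLength k (e N)) := ⟨(hpos _).ne'⟩
      have hy' := (shiftBy_mem_iff hinv (-(ψ (e N) y).val : ℤ) y).2 hy
      refine ⟨N, _, ⟨_, hy', ?_, rfl⟩, hR l _ hN z hz _ hy' m 0⟩
      rw [hψ.map_shiftBy hinv _ hy]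
      simp
    · intro hz
      refine hX.isSymbolicSystem.mem_of_subword fun m l => ?_
      obtain ⟨n, _, ⟨y, hy, -, rfl⟩, h⟩ := hz m l
      obtain ⟨d, -, h⟩ := subword_isInfix_iff.1 h
      exact ⟨y, hy, 0 + d, subword_eq_iff.2 h⟩

end OdometerBased

/-! ### Positions in the first six blocks -/

section Measure

variable {k : ℕ → ℕ} {α : Type*} [TopologicalSpace α] {X : Set (ℤ → α)}
  {φ : ∀ n, (ℤ → α) → ZMod (presentationLength k n)}

/-- The sequences of `X` whose position `m` lies, at every stage, in one of the first six
subblocks of its block. -/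
def undetermined (X : Set (ℤ → α)) (φ : ∀ n, (ℤ → α) → ZMod (presentationLength k n)) (m : ℤ) :
    Set (ℤ → α) :=
  {x ∈ X | ∀ n, (φ (n + 1) x + m).val < 6 * presentationLength k n}

theorem IsBlockPosition.isClosed_fiber (hφ : IsBlockPosition k X φ) (hX : IsClosed X) (n : ℕ)
    (S : Set (ZMod (presentationLength k n))) : IsClosed (X ∩ φ n ⁻¹' S) :=
  (hφ.continuousOn n).preimage_isClosed_of_isClosed hX (isClosed_discrete S)

theorem IsBlockPosition.isClosed_undetermined (hφ : IsBlockPosition k X φ) (hX : IsClosed X)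
    (m : ℤ) : IsClosed (undetermined X φ m) := by
  have : undetermined X φ m = ⋂ n, X ∩ φ (n + 1) ⁻¹'
      {c | (c + m).val < 6 * presentationLength k n} := by
    ext x
    simp only [undetermined, Set.mem_ofPred_eq, Set.mem_iInter, Set.mem_inter_iff,
      Set.mem_preimage]
    exact ⟨fun h n => ⟨h.1, h.2 n⟩, fun h => ⟨(h 0).1, fun n => (h n).2⟩⟩
  rw [this]
  exact isClosed_iInter fun n => hφ.isClosed_fiber hX _ _

theorem IsBlockPosition.shift_mem_undetermined_iff (hφ : IsBlockPosition k X φ)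
    (hX : shift ⁻¹' X = X) (m : ℤ) (x : ℤ → α) :
    shift x ∈ undetermined X φ m ↔ x ∈ undetermined X φ (m + 1) := by
  simp only [undetermined, Set.mem_ofPred_eq, mem_shift_iff_of_preimage hX]
  refine and_congr_right fun hx => forall_congr' fun n => ?_
  rw [hφ.map_shift _ x hx]
  push_cast
  rw [add_right_comm, add_assoc]

variable [Finite α] [DiscreteTopology α] [MeasurableSpace α] [BorelSpace α]
  {μ : Measure (ℤ → α)}

/-- The positions in the blocks of a stage are equally distributed. -/
theorem IsInvariantMeasureOn.measure_fiber (hμ : IsInvariantMeasureOn X μ)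
    (hφ : IsBlockPosition k X φ) (hX : IsSymbolicSystem X) (hk : ∀ n, 0 < k n) (n : ℕ)
    (S : Finset (ZMod (presentationLength k n))) :
    presentationLength k n * μ (X ∩ φ n ⁻¹' S) = S.card := by
  have := hμ.isProbabilityMeasure
  have : NeZero (presentationLength k n) := ⟨(presentationLength_pos hk n).ne'⟩
  have hmeas (c : ZMod (presentationLength k n)) : MeasurableSet (X ∩ φ n ⁻¹' {c}) :=
    (hφ.isClosed_fiber hX.isClosed n _).measurableSet
  have hstep (c : ZMod (presentationLength k n)) :
      μ (X ∩ φ n ⁻¹' {c + 1}) = μ (X ∩ φ n ⁻¹' {c}) := by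
    rw [← hμ.measurePreserving.measure_preimage (hmeas _).nullMeasurableSet]
    congr 1
    ext x
    simp only [Set.mem_preimage, Set.mem_inter_iff, Set.mem_singleton_iff,
      mem_shift_iff_of_preimage hX.invariant]
    refine and_congr_right fun hx => ?_
    rw [hφ.map_shift n x hx, add_left_inj]
  have hconst (c : ZMod (presentationLength k n)) :
      μ (X ∩ φ n ⁻¹' {c}) = μ (X ∩ φ n ⁻¹' {0}) := by
    rw [← ZMod.natCast_zmod_val c]
    induction c.val with
    | zero => simp
    | succ i ih => rw [Nat.cast_succ, hstep, ih]
  have hsum (S : Finset (ZMod (presentationLength k n))) :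
      μ (X ∩ φ n ⁻¹' S) = S.card * μ (X ∩ φ n ⁻¹' {0}) := by
    have hU : X ∩ φ n ⁻¹' S = ⋃ c ∈ S, X ∩ φ n ⁻¹' {c} := by
      ext x; simp
    rw [hU, measure_biUnion_finset _ fun c _ => hmeas c, Finset.sum_congr rfl fun c _ => hconst c,
      Finset.sum_const, nsmul_eq_mul]
    intro c _ c' _ hne
    refine Set.disjoint_left.2 fun x hx hx' => hne ?_
    exact hx.2.symm.trans hx'.2
  have htot := hsum Finset.univ
  have hXμ : μ X = 1 := by
    rw [← prob_compl_eq_zero_iff hX.isClosed.measurableSet]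
    exact hμ.compl_eq_zero
  rw [Finset.coe_univ, Set.preimage_univ, Set.inter_univ, hXμ, Finset.card_univ, ZMod.card]
    at htot
  rw [hsum, mul_left_comm, ← htot, mul_one]

/-- At stage `n + 1` only `6 * q` of the `k n * q` equally likely block positions are allowed, where
`q` is the length at stage `n`. So the measure is at most `6 / k n`, for every `n`. -/
theorem IsInvariantMeasureOn.measure_undetermined (hμ : IsInvariantMeasureOn X μ)
    (hφ : IsBlockPosition k X φ) (hX : IsSymbolicSystem X) (hk : ∀ n, 0 < k n)
    (hk_top : Filter.Tendsto k Filter.atTop Filter.atTop) (m : ℤ) :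
    μ (undetermined X φ m) = 0 := by
  have hle (n : ℕ) : k n * μ (undetermined X φ m) ≤ 6 := by
    have : NeZero (presentationLength k (n + 1)) := ⟨(presentationLength_pos hk _).ne'⟩
    let S : Finset (ZMod (presentationLength k (n + 1))) :=
      Finset.univ.filter fun c => (c + m).val < 6 * presentationLength k n
    have hcard : S.card ≤ 6 * presentationLength k n := by
      have := Finset.card_le_card_of_injOn (s := S)
        (t := Finset.range (6 * presentationLength k n)) (fun c => (c + m).val)
        (fun c hc => by simpa [S] using hc)
        (fun c _ c' _ h => add_right_cancel (ZMod.val_injective _ h))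
      rwa [Finset.card_range] at this
    have hsub : undetermined X φ m ⊆ X ∩ φ (n + 1) ⁻¹' S := fun x hx =>
      ⟨hx.1, by simpa [S] using hx.2 n⟩
    have hq0 : (presentationLength k n : ENNReal) ≠ 0 :=
      Nat.cast_ne_zero.2 (presentationLength_pos hk n).ne'
    refine (ENNReal.mul_le_mul_iff_right hq0 (ENNReal.natCast_ne_top _)).1 ?_
    calc (presentationLength k n : ENNReal) * (k n * μ (undetermined X φ m))
        = presentationLength k (n + 1) * μ (undetermined X φ m) := by
          rw [presentationLength_succ, Nat.cast_mul]; ring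
      _ ≤ presentationLength k (n + 1) * μ (X ∩ φ (n + 1) ⁻¹' S) := by gcongr
      _ = S.card := hμ.measure_fiber hφ hX hk _ S
      _ ≤ (6 * presentationLength k n : ℕ) := Nat.cast_le.2 hcard
      _ = presentationLength k n * 6 := by push_cast; ring
  by_contra h0
  obtain ⟨N, hN⟩ := ENNReal.exists_nat_mul_gt h0 (b := 6) (by simp)
  obtain ⟨n, hn⟩ := (hk_top.eventually_ge_atTop N).exists
  exact absurd (hN.trans_le (mul_le_mul_left (Nat.cast_le.2 hn) _)) (hle n).not_gt

end Measure

/-! ### The fibre product -/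

section FiberProduct

variable {k : ℕ → ℕ} {α : Type*} {X : Set (ℤ → α)}
  {φ : ∀ n, (ℤ → α) → ZMod (presentationLength k n)}

/-- The sequence of first coordinates. -/
def fstSeq {α β : Type*} (z : ℤ → α × β) : ℤ → α := fun i => (z i).1

/-- The sequence of second coordinates. -/
def sndSeq {α β : Type*} (z : ℤ → α × β) : ℤ → β := fun i => (z i).2

theorem continuous_fstSeq {α β : Type*} [TopologicalSpace α] [TopologicalSpace β] :
    Continuous (fstSeq : (ℤ → α × β) → ℤ → α) :=
  continuous_pi fun i => continuous_fst.comp (continuous_apply i)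

theorem continuous_sndSeq {α β : Type*} [TopologicalSpace α] [TopologicalSpace β] :
    Continuous (sndSeq : (ℤ → α × β) → ℤ → β) :=
  continuous_pi fun i => continuous_snd.comp (continuous_apply i)

/-- The pairs of a sequence in `X` and a sequence of the presentation with the same block
positions. -/
def fiberProduct (k : ℕ → ℕ) (X : Set (ℤ → α))
    (φ : ∀ n, (ℤ → α) → ZMod (presentationLength k n)) : Set (ℤ → α × Bool) :=
  {z | fstSeq z ∈ X ∧ ∀ n, IsAligned k n (φ n (fstSeq z)) (sndSeq z)}

theorem IsBlockPosition.isSymbolicSystem_fiberProduct [TopologicalSpace α]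
    (hφ : IsBlockPosition k X φ)
    (hX : IsSymbolicSystem X) (hk : ∀ n, 0 < k n) : IsSymbolicSystem (fiberProduct k X φ) where
  isClosed := by
    -- Splitting by the finitely many residues, whose level sets in `X` are closed, makes alignment
    -- a condition with fixed `r`.
    have : fiberProduct k X φ = ⋂ n, ⋃ r : ZMod (presentationLength k n),
        (fstSeq ⁻¹' (X ∩ φ n ⁻¹' {r}) ∩ sndSeq ⁻¹' {y | IsAligned k n r y}) := by
      ext z
      simp only [fiberProduct, Set.mem_ofPred_eq, Set.mem_iInter, Set.mem_iUnion,
        Set.mem_inter_iff, Set.mem_preimage, Set.mem_singleton_iff]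
      constructor
      · exact fun h n => ⟨_, ⟨h.1, rfl⟩, h.2 n⟩
      · refine fun h => ⟨?_, fun n => ?_⟩
        · obtain ⟨r, h1, h2⟩ := h 0
          exact h1.1
        · obtain ⟨r, h1, h2⟩ := h n
          rwa [h1.2]
    rw [this]
    refine isClosed_iInter fun n => ?_
    have : NeZero (presentationLength k n) := ⟨(presentationLength_pos hk n).ne'⟩
    exact isClosed_iUnion_of_finite fun r =>
      ((hφ.isClosed_fiber hX.isClosed n _).preimage continuous_fstSeq).inter
        ((isClosed_isAligned n r).preimage continuous_sndSeq)
  invariant := by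
    ext z
    have h1 : fstSeq (shift z) = shift (fstSeq z) := rfl
    have h2 : sndSeq (shift z) = shift (sndSeq z) := rfl
    simp only [fiberProduct, Set.mem_preimage, Set.mem_ofPred_eq, h1, h2,
      mem_shift_iff_of_preimage hX.invariant]
    refine and_congr_right fun hz => forall_congr' fun n => ?_
    rw [hφ.map_shift n _ hz, isAligned_shift]

theorem IsBlockPosition.fiberProduct_nonempty [TopologicalSpace α] (hφ : IsBlockPosition k X φ)
    (hX : X.Nonempty) (hk : ∀ n, 0 < k n) : (fiberProduct k X φ).Nonempty := by
  obtain ⟨x, hx⟩ := hX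
  obtain ⟨y, hy⟩ := exists_forall_isAligned hk (fun n => φ n x)
    fun n => hφ.castHom_eq n.le_succ x
  exact ⟨fun i => (x i, y i), hx, hy⟩

theorem fiberProduct_subset_prodSystem (hk : ∀ n, 10 ≤ k n) :
    fiberProduct k X φ ⊆ prodSystem X (odometerPresentation k) :=
  fun _ hz => ⟨hz.1, mem_odometerPresentation hk fun n => ⟨_, hz.2 n⟩⟩

/-- Over a sequence without undetermined positions, the fibre is at most a point. -/
theorem eq_of_mem_fiberProduct (hk : ∀ n, 0 < k n) {z z' : ℤ → α × Bool}
    (hz : z ∈ fiberProduct k X φ) (hz' : z' ∈ fiberProduct k X φ) (h : fstSeq z = fstSeq z')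
    (hdet : ∀ m, fstSeq z ∉ undetermined X φ m) : sndSeq z = sndSeq z' := by
  funext m
  have := hdet m
  simp only [undetermined, Set.mem_ofPred_eq, not_and, not_forall, not_lt] at this
  -- A stage at which `m` lies beyond the first six subblocks. Both second coordinates have the same
  -- block around `m`, and there its type does not matter.
  obtain ⟨n, hn⟩ := this hz.1
  rw [add_comm (φ (n + 1) _)] at hn
  obtain ⟨-, hlt, c, hc⟩ := (hz.2 (n + 1)).exists_block hk m
  obtain ⟨-, -, c', hc'⟩ := (hz'.2 (n + 1)).exists_block hk m
  rw [← h] at hc'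
  have e := hc _ hlt
  have e' := hc' _ hlt
  rw [sub_add_cancel] at e e'
  rw [e, e', presentationLetter_succ_eq hk n c c' hn]

theorem uniquelyReadable_blockWords_fiberProduct (hk : ∀ n, 10 ≤ k n) {Y : Set (ℤ → α × Bool)}
    (hY : Y ⊆ fiberProduct k X φ) (n : ℕ) :
    UniquelyReadable (blockWords k Y (fun n z => φ n (fstSeq z)) n) := by
  refine (uniquelyReadable_presentationWord hk n).of_map Prod.snd ?_
  rintro _ ⟨z, hz, h0, rfl⟩
  obtain ⟨c, hc⟩ := (hY hz).2 n 0 (by rw [Int.cast_zero, zero_add]; exact h0)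
  refine ⟨c, ?_⟩
  rw [presentationWord_eq_subword fun n => (by have := hk n; omega), map_subword, subword_eq_iff]
  intro i hi
  have e := hc i hi
  rw [sndSeq] at e
  rw [e]
  congr 1
  omega

end FiberProduct

/-! ### Projection of invariant measures and conclusion -/

theorem IsInvariantMeasureOn.map_fstSeq {α β : Type*} [MeasurableSpace α] [MeasurableSpace β]
    {X : Set (ℤ → α)} {Z : Set (ℤ → α × β)} {ν : Measure (ℤ → α × β)}
    (hν : IsInvariantMeasureOn Z ν) (hX : MeasurableSet X) (hZ : ∀ z ∈ Z, fstSeq z ∈ X)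
    (hshift : Measurable (shift : (ℤ → α) → ℤ → α)) :
    IsInvariantMeasureOn X (ν.map fstSeq) := by
  have hm : Measurable (fstSeq : (ℤ → α × β) → ℤ → α) :=
    measurable_pi_lambda _ fun i => measurable_fst.comp (measurable_pi_apply i)
  have := hν.isProbabilityMeasure
  refine ⟨Measure.isProbabilityMeasure_map hm.aemeasurable, ?_, hshift, ?_⟩
  · rw [Measure.map_apply hm hX.compl]
    exact measure_mono_null (fun z hz hzZ => hz (hZ z hzZ)) hν.compl_eq_zero
  · rw [Measure.map_map hshift hm]
    conv_rhs => rw [← hν.measurePreserving.map_eq]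
    rw [Measure.map_map hm hν.measurePreserving.measurable]
    rfl

theorem mainTheorem4 {α : Type*} [Finite α] [TopologicalSpace α] [DiscreteTopology α]
    [MeasurableSpace α] [BorelSpace α]
    (x : ℤ → α) (hx : IsToeplitz x)
    (k : ℕ → ℕ) (π : (ℤ → α) → OdometerSpace k)
    (hπ : IsMaximalOdometerFactor (orbitClosure x) k π)
    (hk : ∀ n, 10 ≤ k n) (hk_sum : Summable fun n => 1 / (k n : ℝ)) :
    ∃ L A : Set (ℤ → α × Bool),
      IsOdometerBased L ∧
      L ⊆ prodSystem (orbitClosure x) (odometerPresentation k) ∧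
      A ⊆ L ∧
      IsAugmentation (orbitClosure x) (odometerPresentation k) A ∧
      ∀ ν : Measure (ℤ → α × Bool), IsInvariantMeasureOn L ν → ν A = 1 := by
  have hk0 : ∀ n, 0 < k n := fun n => by have := hk n; omega
  have hk_top : Filter.Tendsto k Filter.atTop Filter.atTop := by
    have h := hk_sum.tendsto_atTop_zero
    simp only [one_div] at h
    have h' : Filter.Tendsto (fun n => (k n : ℝ)) Filter.atTop Filter.atTop := by
      have := Filter.Tendsto.inv_tendsto_nhdsGT_zero (tendsto_nhdsWithin_iff.2
        ⟨h, Filter.Eventually.of_forall fun n => by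
          have := hk0 n
          simpa using this⟩)
      simpa only [Pi.inv_def, inv_inv] using this
    exact tendsto_natCast_atTop_iff.1 h'
  set X := orbitClosure x
  have hX : IsMinimalSystem X := hx.isMinimalSystem
  have hXs := hX.isSymbolicSystem
  have hφ := hπ.toIsOdometerFactor.isBlockPosition
  set φ : ∀ n, (ℤ → α) → ZMod (presentationLength k n) :=
    fun n x => (odometerValue k n (π x) : ZMod (presentationLength k n))
  -- A minimal subsystem provides the recurrence of blocks that a construction sequence demands.
  obtain ⟨L, hLF, hL⟩ := (hφ.isSymbolicSystem_fiberProduct hXs hk0).exists_isMinimalSystem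
    (hφ.fiberProduct_nonempty hX.nonempty hk0)
  have hLs := hL.isSymbolicSystem
  have hψ : IsBlockPosition k L fun n z => φ n (fstSeq z) :=
    { continuousOn := fun n =>
        (hφ.continuousOn n).comp continuous_fstSeq.continuousOn fun z hz => (hLF hz).1
      map_shift := fun n z hz => hφ.map_shift n _ (hLF hz).1
      castHom_eq := fun h z => hφ.castHom_eq h _ }
  -- The image is a non-empty subsystem of the minimal system `X`; surjectivity supplies the
  -- existence of `y` over almost every point.
  have hLX : fstSeq '' L = X := by
    refine hX.eq_of_subset _ ⟨?_, ?_⟩ (hL.nonempty.image _) ?_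
    · exact (hLs.isClosed.isCompact.image continuous_fstSeq).isClosed
    · ext y
      constructor
      · rintro ⟨z, hz, e⟩
        refine ⟨shiftBy (-1) z, (shiftBy_mem_iff hLs.invariant _ _).2 hz, ?_⟩
        funext i
        have := congrFun e (i - 1)
        simp only [shift, sub_add_cancel] at this
        exact this
      · rintro ⟨z, hz, rfl⟩
        exact ⟨shift z, (mem_shift_iff_of_preimage hLs.invariant z).2 hz, rfl⟩
    · rintro _ ⟨z, hz, rfl⟩
      exact (hLF hz).1
  set U : Set (ℤ → α) := ⋃ m, undetermined X φ m with hU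
  have hUmeas : MeasurableSet U :=
    MeasurableSet.iUnion fun m => (hφ.isClosed_undetermined hXs.isClosed m).measurableSet
  have hUnull {μ : Measure (ℤ → α)} (hμ : IsInvariantMeasureOn X μ) : μ U = 0 :=
    measure_iUnion_null fun m => hμ.measure_undetermined hφ hXs hk0 hk_top m
  have hUshift (y : ℤ → α) : shift y ∈ U ↔ y ∈ U := by
    simp only [hU, Set.mem_iUnion, hφ.shift_mem_undetermined_iff hXs.invariant]
    exact ⟨fun ⟨m, h⟩ => ⟨m + 1, h⟩, fun ⟨m, h⟩ => ⟨m - 1, by rwa [sub_add_cancel]⟩⟩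
  have hAmeas : MeasurableSet (L \ fstSeq ⁻¹' U) :=
    hLs.isClosed.measurableSet.diff (continuous_fstSeq.measurable hUmeas)
  refine ⟨L, L \ fstSeq ⁻¹' U, hL.isOdometerBased (fun n => by have := hk n; omega) hψ
    (uniquelyReadable_blockWords_fiberProduct hk hLF),
    hLF.trans (fiberProduct_subset_prodSystem hk), Set.sdiff_subset,
    ⟨hX, isMinimalSystem_odometerPresentation hk,
      Set.sdiff_subset.trans (hLF.trans (fiberProduct_subset_prodSystem hk)), hAmeas, ?_,
      fun μ hμ => ?_⟩, fun ν hν => ?_⟩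
  · rw [Set.preimage_sdiff, hLs.invariant]
    congr 1
    ext z
    exact hUshift (fstSeq z)
  · have hae : ∀ᵐ y ∂μ, y ∈ X := hμ.compl_eq_zero
    have haeU : ∀ᵐ y ∂μ, y ∉ U := measure_eq_zero_iff_ae_notMem.1 (hUnull hμ)
    filter_upwards [hae, haeU] with y hy hyU
    rw [← hLX] at hy
    obtain ⟨z, hz, rfl⟩ := hy
    refine ⟨sndSeq z, ⟨hz, hyU⟩, fun y' hy' => ?_⟩
    exact eq_of_mem_fiberProduct hk0 (hLF hy'.1) (hLF hz) rfl
      fun m hm => hyU (Set.mem_iUnion.2 ⟨m, hm⟩)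
  · have := hν.isProbabilityMeasure
    rw [← prob_compl_eq_zero_iff hAmeas]
    -- The projection of `ν` is an invariant measure on `X`, so the preimage of `U` is `ν`-null.
    have hmap := hUnull (hν.map_fstSeq hXs.isClosed.measurableSet (fun z hz => (hLF hz).1)
      continuous_shift.measurable)
    rw [Measure.map_apply continuous_fstSeq.measurable hUmeas] at hmap
    refine measure_mono_null (fun z hz => ?_) (measure_union_null hν.compl_eq_zero hmap)
    by_cases hzL : z ∈ L
    · exact Or.inr (by_contra fun h => hz ⟨hzL, h⟩)
    · exact Or.inl hzL
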